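/- Let $p_1,\dots,p_n$ ($n\ge 1$) be pairwise distinct sites in the plane in general position: no three on a common line and no four on a common circle. For $i<j$, the Voronoi edge of $p_i$ and $p_j$ is the (possibly empty) set of points of the plane having $p_i$ and $p_j$ as their only two nearest sites; the edges of the Voronoi diagram are the nonempty ones. In the limited workspace model, the input resides in read-only random access memory, the output is written to a write-only stream, and each cell of the read-write workspace stores either an integer of $O(\log n)$ bits (possibly a pointer to an input cell) or a root of a polynomial of bounded degree that depends on a fixed number of input variables. The running time is the number of elementary operations, and the space is the number of workspace cells. There is a deterministic algorithm in this model that, for all such inputs, reports all edges of the Voronoi diagram in $O(n^2)$ time using $O(1)$ cells of workspace. Each edge is reported exactly once, by the indices $i<j$ of its two sites and by its left and right endpoints (seen from $p_i$ towards $p_j$), where an endpoint is marked as missing if the edge is unbounded on that side. Nothing else is reported. -/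

import Mathlib

namespace LimitedWorkspace

/-! ### Voronoi diagrams of planar sites -/

/-- The Euclidean plane. -/
abbrev Plane : Type := EuclideanSpace ℝ (Fin 2)

/-- General position of a family of sites: the sites are pairwise distinct, no three of them lie
on a common line, and no four of them lie on a common circle. -/
def GeneralPosition {n : ℕ} (p : Fin n → Plane) : Prop :=
  Function.Injective p ∧
  (∀ i j k : Fin n, i ≠ j → i ≠ k → j ≠ k → ¬ Collinear ℝ {p i, p j, p k}) ∧
  (∀ i j k l : Fin n, i ≠ j → i ≠ k → i ≠ l → j ≠ k → j ≠ l → k ≠ l →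
    ¬ EuclideanGeometry.Cospherical {p i, p j, p k, p l})

/-- The indices of the sites that are nearest to the point `x`. -/
def nearestSites {n : ℕ} (p : Fin n → Plane) (x : Plane) : Set (Fin n) :=
  {i | ∀ k, dist x (p i) ≤ dist x (p k)}

/-- The (possibly empty) Voronoi edge of the sites `p i` and `p j`, where `i ≠ j`: the points that
have these two as their only nearest sites. -/
def voronoiEdge {n : ℕ} (p : Fin n → Plane) (i j : Fin n) : Set Plane :=
  {x | nearestSites p x = {i, j}}

/-- The vector `v` turned counterclockwise by a right angle. -/
noncomputable def rotLeft (v : Plane) : Plane := !₂[-(v 1), v 0]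

/-- How an edge is reported: the indices of its two sites, and its left and right endpoints as
seen when looking from the first site towards the second. An endpoint is `none` if the edge is
unbounded on that side. -/
structure EdgeReport (n : ℕ) where
  fst : Fin n
  snd : Fin n
  left : Option Plane
  right : Option Plane

/-- The relatively open segment, ray or line on the bisector of the two sites that a report
describes. -/
def EdgeReport.points {n : ℕ} (p : Fin n → Plane) (e : EdgeReport n) : Set Plane :=
  {x | x ∈ AffineSubspace.perpBisector (p e.fst) (p e.snd) ∧
    (∀ a ∈ e.left, 0 < inner ℝ (a - x) (rotLeft (p e.snd - p e.fst))) ∧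
    (∀ b ∈ e.right, 0 < inner ℝ (x - b) (rotLeft (p e.snd - p e.fst)))}

/-- A report is correct if its first site has the smaller index, its endpoints lie on the bisector
of its two sites, and it describes exactly the Voronoi edge of its two sites, which is nonempty. -/
def EdgeReport.Correct {n : ℕ} (p : Fin n → Plane) (e : EdgeReport n) : Prop :=
  e.fst < e.snd ∧
  (∀ a ∈ e.left, a ∈ AffineSubspace.perpBisector (p e.fst) (p e.snd)) ∧
  (∀ b ∈ e.right, b ∈ AffineSubspace.perpBisector (p e.fst) (p e.snd)) ∧
  (voronoiEdge p e.fst e.snd).Nonempty ∧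
  e.points p = voronoiEdge p e.fst e.snd

/-- A word of the output stream: an integer or a real number. -/
abbrev OutWord : Type := ℤ ⊕ ℝ

/-- An endpoint is written as the word `0` if it does not exist, and otherwise as the word `1`
followed by its two coordinates. -/
def encodeEndpoint : Option Plane → List OutWord
  | none => [Sum.inl 0]
  | some a => [Sum.inl 1, Sum.inr (a 0), Sum.inr (a 1)]

/-- A report is written as its two site indices, its left endpoint and its right endpoint. -/
def EdgeReport.encode {n : ℕ} (e : EdgeReport n) : List OutWord :=
  [Sum.inl ((e.fst : ℕ) : ℤ), Sum.inl ((e.snd : ℕ) : ℤ)] ++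
    encodeEndpoint e.left ++ encodeEndpoint e.right

/-- The stream `out` lists all edges of the Voronoi diagram of `p`, each of them exactly once, and
nothing else. -/
def ReportsVoronoiEdges {n : ℕ} (p : Fin n → Plane) (out : List OutWord) : Prop :=
  ∃ L : List (EdgeReport n),
    out = L.flatMap EdgeReport.encode ∧
    (L.map fun e => (e.fst, e.snd)).Nodup ∧
    (∀ e ∈ L, e.Correct p) ∧
    (∀ i j : Fin n, i < j → (voronoiEdge p i j).Nonempty → ∃ e ∈ L, e.fst = i ∧ e.snd = j)

/-! ### The limited workspace model with a constant number of cells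

The input, `n` sites with two coordinates each, is in read-only random access memory. A program
names all cells of its workspace explicitly: `a` cells for integers (which also serve as pointers
to input cells) and `b` cells for real numbers. All intermediate results are kept in these cells.
What a cell can store is limited. Output words go to a write-only stream. -/

/-- Bounds, independent of the input, on what one workspace cell can store. -/
structure CellBounds where
  /-- an integer cell holds at most about `exponent * log (n + 1)` bits -/
  exponent : ℕ
  /-- the number of input variables that a real cell may depend on -/
  arity : ℕ
  /-- the finitely many polynomials, in one unknown and with coefficients depending on `arity`
  input variables, whose roots may be stored in a real cell -/
  polys : Finset (Polynomial (MvPolynomial (Fin arity) ℤ))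

/-- The integer `z` has `O(log n)` bits. -/
def FitsInt (B : CellBounds) (n : ℕ) (z : ℤ) : Prop :=
  |z| ≤ ((n : ℤ) + 1) ^ B.exponent

/-- The real number `x` is a root of one of the allowed polynomials, where its coefficients are
evaluated at some coordinates of input sites and where it does not vanish identically. -/
def FitsReal (B : CellBounds) {n : ℕ} (p : Fin n → Plane) (x : ℝ) : Prop :=
  ∃ P ∈ B.polys, ∃ v : Fin B.arity → Fin n × Fin 2,
    P.map (MvPolynomial.eval₂Hom (Int.castRingHom ℝ) fun t => p (v t).1 (v t).2) ≠ 0 ∧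
    (P.map (MvPolynomial.eval₂Hom (Int.castRingHom ℝ) fun t => p (v t).1 (v t).2)).IsRoot x

/-- The contents of the workspace, and the output written so far. -/
structure State (a b : ℕ) where
  ints : Fin a → ℤ
  reals : Fin b → ℝ
  out : List OutWord

/-- At the start all cells hold zero and nothing has been written. -/
def State.init (a b : ℕ) : State a b := ⟨fun _ => 0, fun _ => 0, []⟩

/-- Store `z` in the integer cell `d`. -/
def State.setInt {a b : ℕ} (σ : State a b) (d : Fin a) (z : ℤ) : State a b :=
  { σ with ints := Function.update σ.ints d z }

/-- Store `x` in the real cell `d`. -/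
def State.setReal {a b : ℕ} (σ : State a b) (d : Fin b) (x : ℝ) : State a b :=
  { σ with reals := Function.update σ.reals d x }

/-- Append `w` to the output stream. -/
def State.emit {a b : ℕ} (σ : State a b) (w : OutWord) : State a b :=
  { σ with out := σ.out ++ [w] }

/-- Comparisons of two cells. -/
inductive Test (a b : ℕ) : Type
  | intLt (s t : Fin a)
  | intEq (s t : Fin a)
  | realLt (s t : Fin b)
  | realEq (s t : Fin b)

/-- The outcome of a comparison. -/
def Test.Holds {a b : ℕ} (σ : State a b) : Test a b → Prop
  | .intLt s t => σ.ints s < σ.ints t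
  | .intEq s t => σ.ints s = σ.ints t
  | .realLt s t => σ.reals s < σ.reals t
  | .realEq s t => σ.reals s = σ.reals t

/-- Elementary instructions; `d` is the cell that receives the result. -/
inductive Instr (a b : ℕ) : Type
  /-- integer constant -/
  | intConst (d : Fin a) (z : ℤ)
  /-- the number of sites -/
  | numSites (d : Fin a)
  | intCopy (d s : Fin a)
  | intAdd (d s t : Fin a)
  | intSub (d s t : Fin a)
  | intMul (d s t : Fin a)
  /-- integer constant in a real cell -/
  | realConst (d : Fin b) (z : ℤ)
  /-- the coordinate `axis` of the site whose index is in the integer cell `s` -/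
  | load (d : Fin b) (s : Fin a) (axis : Fin 2)
  | realCopy (d s : Fin b)
  | realAdd (d s t : Fin b)
  | realSub (d s t : Fin b)
  | realMul (d s t : Fin b)
  | realDiv (d s t : Fin b)
  /-- write an integer cell to the output -/
  | writeInt (s : Fin a)
  /-- write a real cell to the output -/
  | writeReal (s : Fin b)

/-- The effect of one elementary instruction. It is not executable if the result does not fit into
a cell, if a site index is out of range, or if a divisor is zero. -/
inductive Instr.Step {a b n : ℕ} (B : CellBounds) (p : Fin n → Plane) :
    Instr a b → State a b → State a b → Prop
  | intConst (σ : State a b) (d : Fin a) (z : ℤ) (h : FitsInt B n z) :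
      Instr.Step B p (.intConst d z) σ (σ.setInt d z)
  | numSites (σ : State a b) (d : Fin a) (h : FitsInt B n n) :
      Instr.Step B p (.numSites d) σ (σ.setInt d n)
  | intCopy (σ : State a b) (d s : Fin a) (h : FitsInt B n (σ.ints s)) :
      Instr.Step B p (.intCopy d s) σ (σ.setInt d (σ.ints s))
  | intAdd (σ : State a b) (d s t : Fin a) (h : FitsInt B n (σ.ints s + σ.ints t)) :
      Instr.Step B p (.intAdd d s t) σ (σ.setInt d (σ.ints s + σ.ints t))
  | intSub (σ : State a b) (d s t : Fin a) (h : FitsInt B n (σ.ints s - σ.ints t)) :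
      Instr.Step B p (.intSub d s t) σ (σ.setInt d (σ.ints s - σ.ints t))
  | intMul (σ : State a b) (d s t : Fin a) (h : FitsInt B n (σ.ints s * σ.ints t)) :
      Instr.Step B p (.intMul d s t) σ (σ.setInt d (σ.ints s * σ.ints t))
  | realConst (σ : State a b) (d : Fin b) (z : ℤ) (h : FitsReal B p z) :
      Instr.Step B p (.realConst d z) σ (σ.setReal d z)
  | load (σ : State a b) (d : Fin b) (s : Fin a) (axis : Fin 2) (i : Fin n)
      (hi : σ.ints s = ((i : ℕ) : ℤ)) (h : FitsReal B p (p i axis)) :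
      Instr.Step B p (.load d s axis) σ (σ.setReal d (p i axis))
  | realCopy (σ : State a b) (d s : Fin b) (h : FitsReal B p (σ.reals s)) :
      Instr.Step B p (.realCopy d s) σ (σ.setReal d (σ.reals s))
  | realAdd (σ : State a b) (d s t : Fin b) (h : FitsReal B p (σ.reals s + σ.reals t)) :
      Instr.Step B p (.realAdd d s t) σ (σ.setReal d (σ.reals s + σ.reals t))
  | realSub (σ : State a b) (d s t : Fin b) (h : FitsReal B p (σ.reals s - σ.reals t)) :
      Instr.Step B p (.realSub d s t) σ (σ.setReal d (σ.reals s - σ.reals t))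
  | realMul (σ : State a b) (d s t : Fin b) (h : FitsReal B p (σ.reals s * σ.reals t)) :
      Instr.Step B p (.realMul d s t) σ (σ.setReal d (σ.reals s * σ.reals t))
  | realDiv (σ : State a b) (d s t : Fin b) (h0 : σ.reals t ≠ 0)
      (h : FitsReal B p (σ.reals s / σ.reals t)) :
      Instr.Step B p (.realDiv d s t) σ (σ.setReal d (σ.reals s / σ.reals t))
  | writeInt (σ : State a b) (s : Fin a) :
      Instr.Step B p (.writeInt s) σ (σ.emit (Sum.inl (σ.ints s)))
  | writeReal (σ : State a b) (s : Fin b) :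
      Instr.Step B p (.writeReal s) σ (σ.emit (Sum.inr (σ.reals s)))

/-- Deterministic programs with `a` integer cells and `b` real cells. -/
inductive Program (a b : ℕ) : Type
  | skip
  | instr (c : Instr a b)
  | seq (P Q : Program a b)
  | branch (t : Test a b) (P Q : Program a b)
  | loop (t : Test a b) (P : Program a b)

/-- `Run B p P σ T τ`: the program `P`, started in the state `σ` on the input `p`, halts in the
state `τ` after exactly `T` elementary operations. Every instruction and every evaluation of a
comparison counts as one operation. `loop t P` repeats `P` as long as `t` holds. -/
inductive Run {a b n : ℕ} (B : CellBounds) (p : Fin n → Plane) :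
    Program a b → State a b → ℕ → State a b → Prop
  | skip (σ : State a b) : Run B p .skip σ 1 σ
  | instr (c : Instr a b) (σ τ : State a b) (h : Instr.Step B p c σ τ) :
      Run B p (.instr c) σ 1 τ
  | seq (P Q : Program a b) (σ τ ρ : State a b) (T U : ℕ)
      (hP : Run B p P σ T τ) (hQ : Run B p Q τ U ρ) :
      Run B p (.seq P Q) σ (T + U) ρ
  | branchTrue (t : Test a b) (P Q : Program a b) (σ τ : State a b) (T : ℕ)
      (ht : t.Holds σ) (hP : Run B p P σ T τ) :
      Run B p (.branch t P Q) σ (T + 1) τ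
  | branchFalse (t : Test a b) (P Q : Program a b) (σ τ : State a b) (T : ℕ)
      (ht : ¬ t.Holds σ) (hQ : Run B p Q σ T τ) :
      Run B p (.branch t P Q) σ (T + 1) τ
  | loopDone (t : Test a b) (P : Program a b) (σ : State a b) (ht : ¬ t.Holds σ) :
      Run B p (.loop t P) σ 1 σ
  | loopStep (t : Test a b) (P : Program a b) (σ τ ρ : State a b) (T U : ℕ)
      (ht : t.Holds σ) (hP : Run B p P σ T τ) (hL : Run B p (.loop t P) τ U ρ) :
      Run B p (.loop t P) σ (T + 1 + U) ρ

end LimitedWorkspace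

open LimitedWorkspace

namespace LimitedWorkspace

open Filter Topology

/-! The algorithm walks around one Voronoi cell after another. On the bisector of `p i` and `p j`,
parametrized by `t`, another site `p k` is farther away than `p i` exactly when `t * turn p i j k <
cornerInner p i j k` (`sqDist_bisectorPoint`). Sites to the left bound `t` from above, sites to the
right from below, and the tightest bound on each side is the edge's endpoint. So one scan over all
sites computes an edge in linear time and constant space, together with the sites that bound it.

If `k` bounds the edge of `i` and `j`, the endpoint is the centre of a circle through the three
sites with all other sites outside, hence `i` and `k` share an edge too, the next one around the
cell of `i` (`IsNext.neighbors`, `IsNext.reverse`). A nearest site supplies the starting neighbour.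
The walk turns left until it returns to its start or meets an unbounded edge; in the latter case a
second walk turns right from the start. Either way the set visited is closed under taking
successors, and `mem_of_closed` shows by an angular argument that such a set contains all
neighbours. Each edge is met from both of its cells and written only from the site of smaller index.

The cost is linear per visited edge, so a linear bound on the number of edges is needed
(`sum_card_neighborFinset_le`). Instead of Euler's formula, a charging argument is used: project the
sites injectively to a line; a Voronoi vertex is the unique extreme point, perpendicular to the
projection direction, of the cell of the middle one of its three sites. A cell has at most two such
extreme points, so there are at most `2 * n` vertices.

Each value kept in a real cell is one of finitely many rational functions of the coordinates of at
most three sites, hence a root of a linear polynomial from a fixed list (`fitsReal_eval`). Running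
time and correctness are proved together by the total-correctness triples `Ends`. -/

/-! ### Sites, bisectors and empty circles in coordinates -/

/-- The squared Euclidean distance in coordinates. -/
def sqDist (x y : Plane) : ℝ := (x 0 - y 0) ^ 2 + (x 1 - y 1) ^ 2

lemma dist_eq_sqrt_sqDist (x y : Plane) : dist x y = √(sqDist x y) := by
  simp [EuclideanSpace.dist_eq, Fin.sum_univ_two, sqDist, Real.dist_eq, sq_abs]

lemma sqDist_nonneg (x y : Plane) : 0 ≤ sqDist x y := by
  unfold sqDist; positivity

lemma dist_le_dist_iff_sqDist (x y z w : Plane) :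
    dist x y ≤ dist z w ↔ sqDist x y ≤ sqDist z w := by
  rw [dist_eq_sqrt_sqDist, dist_eq_sqrt_sqDist, Real.sqrt_le_sqrt_iff (sqDist_nonneg _ _)]

lemma dist_eq_dist_iff_sqDist (x y z w : Plane) :
    dist x y = dist z w ↔ sqDist x y = sqDist z w := by
  rw [le_antisymm_iff, dist_le_dist_iff_sqDist, dist_le_dist_iff_sqDist, ← le_antisymm_iff]

lemma plane_ext {x y : Plane} (h0 : x 0 = y 0) (h1 : x 1 = y 1) : x = y := by
  ext t
  fin_cases t
  · exact h0
  · exact h1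

variable {n : ℕ} {p : Fin n → Plane}

/-- Twice the signed area of the triangle with corners `p i`, `p j`, `p k`. -/
def turn (p : Fin n → Plane) (i j k : Fin n) : ℝ :=
  (p j 0 - p i 0) * (p k 1 - p i 1) - (p j 1 - p i 1) * (p k 0 - p i 0)

/-- The inner product of `p k - p i` and `p k - p j`. -/
def cornerInner (p : Fin n → Plane) (i j k : Fin n) : ℝ :=
  (p k 0 - p i 0) * ((p k 0 - p i 0) - (p j 0 - p i 0)) +
    (p k 1 - p i 1) * ((p k 1 - p i 1) - (p j 1 - p i 1))

/-- The parameter of the centre of the circle through `p i`, `p j`, `p k` on the bisector of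
`p i` and `p j`. -/
noncomputable def centerParam (p : Fin n → Plane) (i j k : Fin n) : ℝ :=
  cornerInner p i j k / turn p i j k

/-- The parametrization of the bisector of `p i` and `p j` that starts at the midpoint. -/
noncomputable def bisectorPoint (p : Fin n → Plane) (i j : Fin n) (t : ℝ) : Plane :=
  !₂[p i 0 + ((p j 0 - p i 0) - t * (p j 1 - p i 1)) / 2,
    p i 1 + ((p j 1 - p i 1) + t * (p j 0 - p i 0)) / 2]

@[simp] lemma bisectorPoint_zero (i j : Fin n) (t : ℝ) :
    bisectorPoint p i j t 0 = p i 0 + ((p j 0 - p i 0) - t * (p j 1 - p i 1)) / 2 := rfl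

@[simp] lemma bisectorPoint_one (i j : Fin n) (t : ℝ) :
    bisectorPoint p i j t 1 = p i 1 + ((p j 1 - p i 1) + t * (p j 0 - p i 0)) / 2 := rfl

/-- The quadratic terms of the two squared distances cancel, so their difference is affine in `t`.
Each further site thus imposes one linear inequality on the parameter. -/
lemma sqDist_bisectorPoint (i j k : Fin n) (t : ℝ) :
    sqDist (bisectorPoint p i j t) (p k) =
      sqDist (bisectorPoint p i j t) (p i) + (cornerInner p i j k - t * turn p i j k) := by
  simp only [sqDist, bisectorPoint_zero, bisectorPoint_one, cornerInner, turn]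
  ring

lemma sqDist_bisectorPoint_right (i j : Fin n) (t : ℝ) :
    sqDist (bisectorPoint p i j t) (p j) = sqDist (bisectorPoint p i j t) (p i) := by
  simp only [sqDist, bisectorPoint_zero, bisectorPoint_one]
  ring

lemma turn_swap (i j k : Fin n) : turn p i k j = -turn p i j k := by
  unfold turn; ring

lemma sqDist_pos {x y : Plane} (h : x ≠ y) : 0 < sqDist x y := by
  have := dist_pos.2 h
  rwa [dist_eq_sqrt_sqDist, Real.sqrt_pos] at this

lemma exists_eq_bisectorPoint {i j : Fin n} (hij : p i ≠ p j) {x : Plane}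
    (hx : sqDist x (p i) = sqDist x (p j)) : ∃ t, x = bisectorPoint p i j t := by
  have hu : 0 < (p j 0 - p i 0) ^ 2 + (p j 1 - p i 1) ^ 2 := sqDist_pos hij.symm
  -- Twice the component of `x - p i` along the rotated vector `p j - p i`, relative to its squared
  -- length.
  refine ⟨2 * ((p j 0 - p i 0) * (x 1 - p i 1) - (p j 1 - p i 1) * (x 0 - p i 0)) /
    ((p j 0 - p i 0) ^ 2 + (p j 1 - p i 1) ^ 2), plane_ext ?_ ?_⟩
  · simp only [sqDist] at hx
    simp only [bisectorPoint_zero]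
    field_simp
    linear_combination (p j 0 - p i 0) * hx
  · simp only [sqDist] at hx
    simp only [bisectorPoint_one]
    field_simp
    linear_combination (p j 1 - p i 1) * hx

lemma bisectorPoint_mem_perpBisector (i j : Fin n) (t : ℝ) :
    bisectorPoint p i j t ∈ AffineSubspace.perpBisector (p i) (p j) := by
  rw [AffineSubspace.mem_perpBisector_iff_dist_eq, dist_eq_dist_iff_sqDist,
    sqDist_bisectorPoint_right]

/-- The sites `p i` and `p j` are Voronoi neighbours. -/
def Neighbors (p : Fin n → Plane) (i j : Fin n) : Prop :=
  i ≠ j ∧ ∃ t, ∀ k, k ≠ i → k ≠ j → t * turn p i j k < cornerInner p i j k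

lemma bisectorPoint_mem_voronoiEdge_iff {i j : Fin n} {t : ℝ} :
    bisectorPoint p i j t ∈ voronoiEdge p i j ↔
      ∀ k, k ≠ i → k ≠ j → t * turn p i j k < cornerInner p i j k := by
  have hj := sqDist_bisectorPoint_right (p := p) i j t
  simp only [voronoiEdge, Set.mem_ofPred_eq, nearestSites, dist_le_dist_iff_sqDist]
  constructor
  · intro h k hki hkj
    by_contra! hle
    have hi : i ∈ ({i, j} : Set (Fin n)) := by simp
    rw [← h] at hi
    have hk : k ∈ ({i, j} : Set (Fin n)) := by
      rw [← h]
      intro l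
      have := hi l
      rw [sqDist_bisectorPoint i j k]
      linarith
    simp [hki, hkj] at hk
  · intro h
    have hi : ∀ l, sqDist (bisectorPoint p i j t) (p i) ≤ sqDist (bisectorPoint p i j t) (p l) := by
      intro l
      by_cases hli : l = i
      · rw [hli]
      by_cases hlj : l = j
      · rw [hlj, hj]
      have := h l hli hlj
      rw [sqDist_bisectorPoint i j l]
      linarith
    ext l
    simp only [Set.mem_ofPred_eq, Set.mem_insert_iff, Set.mem_singleton_iff]
    constructor
    · intro hl
      by_contra! hne
      have h1 := h l hne.1 hne.2
      have h2 := hl i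
      rw [sqDist_bisectorPoint i j l] at h2
      linarith
    · rintro (rfl | rfl)
      · exact hi
      · rwa [hj]

lemma exists_eq_bisectorPoint_of_mem_voronoiEdge {i j : Fin n} (hij : p i ≠ p j) {x : Plane}
    (hx : x ∈ voronoiEdge p i j) : ∃ t, x = bisectorPoint p i j t := by
  apply exists_eq_bisectorPoint hij
  have hi : i ∈ nearestSites p x := by rw [show nearestSites p x = {i, j} from hx]; simp
  have hj : j ∈ nearestSites p x := by rw [show nearestSites p x = {i, j} from hx]; simp
  exact le_antisymm ((dist_le_dist_iff_sqDist _ _ _ _).1 (hi j))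
    ((dist_le_dist_iff_sqDist _ _ _ _).1 (hj i))

lemma GeneralPosition.ne (hp : GeneralPosition p) {i j : Fin n} (hij : i ≠ j) : p i ≠ p j :=
  fun h => hij (hp.1 h)

lemma voronoiEdge_nonempty_iff (hp : GeneralPosition p) {i j : Fin n} (hij : i ≠ j) :
    (voronoiEdge p i j).Nonempty ↔ Neighbors p i j := by
  constructor
  · rintro ⟨x, hx⟩
    obtain ⟨t, rfl⟩ := exists_eq_bisectorPoint_of_mem_voronoiEdge (hp.ne hij) hx
    exact ⟨hij, t, bisectorPoint_mem_voronoiEdge_iff.1 hx⟩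
  · rintro ⟨-, t, ht⟩
    exact ⟨_, bisectorPoint_mem_voronoiEdge_iff.2 ht⟩

lemma GeneralPosition.turn_ne_zero (hp : GeneralPosition p) {i j k : Fin n} (hij : i ≠ j)
    (hik : i ≠ k) (hjk : j ≠ k) : turn p i j k ≠ 0 := by
  intro h
  apply hp.2.1 i j k hij hik hjk
  have hu : 0 < (p j 0 - p i 0) ^ 2 + (p j 1 - p i 1) ^ 2 := sqDist_pos (hp.ne hij).symm
  rw [collinear_iff_of_mem (p₀ := p i) (by simp)]
  refine ⟨p j - p i, ?_⟩
  rintro q (rfl | rfl | rfl)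
  · exact ⟨0, by simp⟩
  · exact ⟨1, by simp⟩
  -- The coefficient of the orthogonal projection of `p k - p i` onto `p j - p i`.
  · refine ⟨((p j 0 - p i 0) * (p k 0 - p i 0) + (p j 1 - p i 1) * (p k 1 - p i 1)) /
      ((p j 0 - p i 0) ^ 2 + (p j 1 - p i 1) ^ 2), ?_⟩
    unfold turn at h
    apply plane_ext
    · simp only [vadd_eq_add, PiLp.add_apply, PiLp.smul_apply, PiLp.sub_apply, smul_eq_mul]
      field_simp
      linear_combination (-(p j 1 - p i 1)) * h
    · simp only [vadd_eq_add, PiLp.add_apply, PiLp.smul_apply, PiLp.sub_apply, smul_eq_mul]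
      field_simp
      linear_combination (p j 0 - p i 0) * h

lemma GeneralPosition.not_four_equidistant (hp : GeneralPosition p) {i j k l : Fin n}
    (hij : i ≠ j) (hik : i ≠ k) (hil : i ≠ l) (hjk : j ≠ k) (hjl : j ≠ l) (hkl : k ≠ l)
    {x : Plane} (hj : sqDist x (p j) = sqDist x (p i)) (hk : sqDist x (p k) = sqDist x (p i)) :
    sqDist x (p l) ≠ sqDist x (p i) := by
  intro hl
  apply hp.2.2 i j k l hij hik hil hjk hjl hkl
  refine ⟨x, dist x (p i), ?_⟩
  rintro q (rfl | rfl | rfl | rfl)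
  · exact dist_comm _ _
  · rw [dist_comm]; exact (dist_eq_dist_iff_sqDist _ _ _ _).2 hj
  · rw [dist_comm]; exact (dist_eq_dist_iff_sqDist _ _ _ _).2 hk
  · rw [dist_comm]; exact (dist_eq_dist_iff_sqDist _ _ _ _).2 hl

/-! ### Bounding sites, empty circles and consecutive edges of a cell -/

/-- The site `o` bounds the edge of `p i` and `p j` on the left (`ε = 1`) or on the right
(`ε = -1`); the edge is unbounded on that side if `o = none`. -/
def IsNext (p : Fin n → Plane) (ε : ℝ) (i j : Fin n) : Option (Fin n) → Prop
  | none => ∀ k, k ≠ i → k ≠ j → ε * turn p i j k ≤ 0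
  | some k => k ≠ i ∧ k ≠ j ∧ 0 < ε * turn p i j k ∧
      ∀ l, l ≠ i → l ≠ j → 0 < ε * turn p i j l →
        ε * centerParam p i j k ≤ ε * centerParam p i j l

/-- The point `x` is the centre of a circle through `p i`, `p j`, `p k` that has all other sites
outside. -/
def EmptyCircle (p : Fin n → Plane) (i j k : Fin n) (x : Plane) : Prop :=
  sqDist x (p j) = sqDist x (p i) ∧ sqDist x (p k) = sqDist x (p i) ∧
    ∀ l, l ≠ i → l ≠ j → l ≠ k → sqDist x (p i) < sqDist x (p l)

lemma EmptyCircle.swap {i j k : Fin n} {x : Plane} (h : EmptyCircle p i j k x) :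
    EmptyCircle p i k j x :=
  ⟨h.2.1, h.1, fun l h1 h2 h3 => h.2.2 l h1 h3 h2⟩

/-- Sites on the side `ε` are not inside the circle because `k` is minimal. Sites on the other side
are not inside because the edge is nonempty: its parameter lies beyond their bounds and before that
of `k`. The circle itself carries no fourth site by general position. -/
lemma IsNext.emptyCircle (hp : GeneralPosition p) {ε : ℝ} (hε : ε = 1 ∨ ε = -1)
    {i j k : Fin n} (hij : Neighbors p i j) (h : IsNext p ε i j (some k)) :
    EmptyCircle p i j k (bisectorPoint p i j (centerParam p i j k)) := by
  obtain ⟨hki, hkj, hpos, hmin⟩ := h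
  obtain ⟨hne, t, ht⟩ := hij
  have hck : turn p i j k ≠ 0 := hp.turn_ne_zero hne hki.symm hkj.symm
  have hkk : sqDist (bisectorPoint p i j (centerParam p i j k)) (p k) =
      sqDist (bisectorPoint p i j (centerParam p i j k)) (p i) := by
    rw [sqDist_bisectorPoint, centerParam, div_mul_cancel₀ _ hck]
    ring
  refine ⟨sqDist_bisectorPoint_right _ _ _, hkk, fun l hli hlj hlk => ?_⟩
  have hcl : turn p i j l ≠ 0 := hp.turn_ne_zero hne hli.symm hlj.symm
  have hl := ht l hli hlj
  have hk := ht k hki hkj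
  have hnl : cornerInner p i j l = centerParam p i j l * turn p i j l := by
    rw [centerParam, div_mul_cancel₀ _ hcl]
  have hnk : cornerInner p i j k = centerParam p i j k * turn p i j k := by
    rw [centerParam, div_mul_cancel₀ _ hck]
  have hle : sqDist (bisectorPoint p i j (centerParam p i j k)) (p i) ≤
      sqDist (bisectorPoint p i j (centerParam p i j k)) (p l) := by
    rw [sqDist_bisectorPoint i j l, hnl]
    rw [hnl] at hl
    rw [hnk] at hk
    by_cases hs : 0 < ε * turn p i j l
    · have := hmin l hli hlj hs
      rcases hε with rfl | rfl <;> nlinarith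
    · push Not at hs
      rcases hε with rfl | rfl <;> nlinarith
  exact lt_of_le_of_ne hle (Ne.symm (hp.not_four_equidistant hne hki.symm hli.symm hkj.symm
    hlj.symm hlk.symm (sqDist_bisectorPoint_right _ _ _) hkk))

lemma EmptyCircle.exists_param {i j k : Fin n} (hij : p i ≠ p j) {x : Plane}
    (h : EmptyCircle p i j k x) : ∃ t, x = bisectorPoint p i j t ∧
      t * turn p i j k = cornerInner p i j k ∧
      ∀ l, l ≠ i → l ≠ j → l ≠ k → t * turn p i j l < cornerInner p i j l := by
  obtain ⟨t, rfl⟩ := exists_eq_bisectorPoint hij h.1.symm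
  refine ⟨t, rfl, ?_, fun l h1 h2 h3 => ?_⟩
  · have := h.2.1
    rw [sqDist_bisectorPoint] at this
    linarith
  · have := h.2.2 l h1 h2 h3
    rw [sqDist_bisectorPoint i j l] at this
    linarith

/-- Moving the centre slightly along the bisector, away from `p k`, makes the inequality for `k`
strict; the finitely many other strict inequalities survive a small move. -/
lemma EmptyCircle.neighbors (hp : GeneralPosition p) {i j k : Fin n} (hij : i ≠ j) (hik : i ≠ k)
    (hjk : j ≠ k) {x : Plane} (h : EmptyCircle p i j k x) : Neighbors p i j := by
  obtain ⟨t, -, htk, htl⟩ := h.exists_param (hp.ne hij)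
  have hck : turn p i j k ≠ 0 := hp.turn_ne_zero hij hik hjk
  have hev : ∀ᶠ δ : ℝ in 𝓝[>] 0, ∀ l, l ≠ i → l ≠ j → l ≠ k →
      (t - δ * turn p i j k) * turn p i j l < cornerInner p i j l := by
    rw [eventually_all]
    intro l
    by_cases hl : l ≠ i ∧ l ≠ j ∧ l ≠ k
    · have hc : Continuous fun δ : ℝ => (t - δ * turn p i j k) * turn p i j l := by fun_prop
      have := (hc.tendsto 0).eventually
        (gt_mem_nhds (show _ < cornerInner p i j l by simpa using htl l hl.1 hl.2.1 hl.2.2))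
      filter_upwards [mem_nhdsWithin_of_mem_nhds this] with δ hδ _ _ _ using hδ
    · exact Eventually.of_forall fun δ h1 h2 h3 => absurd ⟨h1, h2, h3⟩ hl
  obtain ⟨δ, hδ, hpos⟩ := (hev.and self_mem_nhdsWithin).exists
  refine ⟨hij, t - δ * turn p i j k, fun l hli hlj => ?_⟩
  by_cases hlk : l = k
  · subst hlk
    have : 0 < δ * (turn p i j l * turn p i j l) := mul_pos hpos (mul_self_pos.2 hck)
    nlinarith
  · exact hδ l hli hlj hlk

/-- Any competitor on the same side lies outside the circle, so its bound on the parameter is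
strictly weaker than that of `k`; `none` is excluded since `k` itself is on that side. -/
lemma EmptyCircle.eq_some_of_isNext (hp : GeneralPosition p) {ε : ℝ} (hε : ε = 1 ∨ ε = -1)
    {i j k : Fin n} (hij : i ≠ j) (hik : i ≠ k) (hjk : j ≠ k) {x : Plane}
    (h : EmptyCircle p i j k x) (hpos : 0 < ε * turn p i j k) {o : Option (Fin n)}
    (ho : IsNext p ε i j o) : o = some k := by
  obtain ⟨t, -, htk, htl⟩ := h.exists_param (hp.ne hij)
  match o, ho with
  | none, ho => exact absurd (ho k hik.symm hjk.symm) (not_le.2 hpos)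
  | some l, ⟨hli, hlj, hlpos, hmin⟩ =>
    by_contra hne
    have hlk : l ≠ k := fun h => hne (by rw [h])
    have h1 := htl l hli hlj hlk
    have h2 := hmin k hik.symm hjk.symm hpos
    have hck : turn p i j k ≠ 0 := hp.turn_ne_zero hij hik hjk
    have hcl : turn p i j l ≠ 0 := hp.turn_ne_zero hij hli.symm hlj.symm
    have hnl : cornerInner p i j l = centerParam p i j l * turn p i j l := by
      rw [centerParam, div_mul_cancel₀ _ hcl]
    have hk : centerParam p i j k = t := by
      rw [centerParam, ← htk, mul_div_cancel_right₀ _ hck]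
    rw [hk] at h2
    rw [hnl] at h1
    rcases hε with rfl | rfl <;> nlinarith

lemma neg_sign {ε : ℝ} (hε : ε = 1 ∨ ε = -1) : -ε = 1 ∨ -ε = -1 := by
  rcases hε with rfl | rfl <;> simp

lemma IsNext.neighbors (hp : GeneralPosition p) {ε : ℝ} (hε : ε = 1 ∨ ε = -1)
    {i j k : Fin n} (hij : Neighbors p i j) (h : IsNext p ε i j (some k)) :
    Neighbors p i k :=
  (h.emptyCircle hp hε hij).swap.neighbors hp h.1.symm hij.1 h.2.1

/-- The edges of `i` with `j` and with `k` end in the centre of the same empty circle, and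
exchanging `j` and `k` flips the orientation. Hence the step from one edge to the next can be
undone. -/
lemma IsNext.reverse (hp : GeneralPosition p) {ε : ℝ} (hε : ε = 1 ∨ ε = -1)
    {i j k : Fin n} (hij : Neighbors p i j) (h : IsNext p ε i j (some k)) {o : Option (Fin n)}
    (ho : IsNext p (-ε) i k o) : o = some j :=
  (h.emptyCircle hp hε hij).swap.eq_some_of_isNext hp (neg_sign hε) h.1.symm hij.1 h.2.1
    (by rw [turn_swap]; linarith [h.2.2.1]) ho

lemma IsNext.unique (hp : GeneralPosition p) {ε : ℝ} (hε : ε = 1 ∨ ε = -1)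
    {i j : Fin n} (hij : Neighbors p i j) {o o' : Option (Fin n)}
    (h : IsNext p ε i j o) (h' : IsNext p ε i j o') : o = o' := by
  match o, o', h, h' with
  | none, none, _, _ => rfl
  | some k, o', h, h' =>
    exact ((h.emptyCircle hp hε hij).eq_some_of_isNext hp hε hij.1 h.1.symm h.2.1.symm
      h.2.2.1 h').symm
  | none, some k, h, h' =>
    exact (h'.emptyCircle hp hε hij).eq_some_of_isNext hp hε hij.1 h'.1.symm h'.2.1.symm
      h'.2.2.1 h

lemma exists_isNext (p : Fin n → Plane) (ε : ℝ) (i j : Fin n) : ∃ o, IsNext p ε i j o := by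
  classical
  by_cases hne : (Finset.univ.filter fun k => k ≠ i ∧ k ≠ j ∧ 0 < ε * turn p i j k).Nonempty
  · obtain ⟨k, hk, hmin⟩ := Finset.exists_min_image _ (fun k => ε * centerParam p i j k) hne
    simp only [Finset.mem_filter, Finset.mem_univ, true_and] at hk hmin
    exact ⟨some k, hk.1, hk.2.1, hk.2.2, fun l h1 h2 h3 => hmin l ⟨h1, h2, h3⟩⟩
  · refine ⟨none, fun k h1 h2 => ?_⟩
    by_contra! h3
    exact hne ⟨k, by simp [h1, h2, h3]⟩

/-- The midpoint, `t = 0`, is on the edge: with `u = p j - p i` and `w = p k - p i`, twice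
`cornerInner` is `|w|² + |w - u|² - |u|²`, which is positive. This provides the starting edge of a
walk. -/
lemma neighbors_of_nearest (hp : GeneralPosition p) {i j : Fin n} (hij : i ≠ j)
    (h : ∀ k, k ≠ i → sqDist (p j) (p i) ≤ sqDist (p k) (p i)) : Neighbors p i j := by
  refine ⟨hij, 0, fun k hki hkj => ?_⟩
  have h1 := h k hki
  have h2 := sqDist_pos (hp.ne hkj)
  unfold sqDist at h1 h2
  unfold cornerInner
  nlinarith

/-! ### Walking around a Voronoi cell meets all neighbours -/

/-- No neighbour lies strictly between two consecutive neighbours. -/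
lemma EmptyCircle.not_neighbors_between (hp : GeneralPosition p) {ε : ℝ}
    {i j k l : Fin n} {x : Plane} (hij : i ≠ j) (hik : i ≠ k)
    (h : EmptyCircle p i j k x) (hjk : 0 < ε * turn p i j k) (hjl : 0 < ε * turn p i j l)
    (hlk : 0 < ε * turn p i l k) : ¬ Neighbors p i l := by
  intro hl
  obtain ⟨t, rfl, htk, htl⟩ := h.exists_param (hp.ne hij)
  obtain ⟨hil, s, hs⟩ := hl
  have hjl' : j ≠ l := by rintro rfl; simp [turn] at hjl; nlinarith
  have hkl' : k ≠ l := by rintro rfl; simp [turn] at hlk; nlinarith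
  have h1 := htl l hil.symm hjl'.symm hkl'.symm
  have h2 := hs j hij.symm hjl'
  have h3 := hs k hik.symm hkl'
  -- Let `g_q(z) = |z - p q|² - |z - p i|²`. By Cramer's rule for `p l - p i` in terms of the
  -- directions to `p j` and `p k`, the combination `turn p i j k * g_l - turn p i l k * g_j - turn
  -- p i j l * g_k` does not depend on `z`. The identity compares its values, times `ε`, at the
  -- centre of the circle, where it is positive, and at the supposed point of the edge of `i` and
  -- `l`, where it is negative.
  have e1 : ε * turn p i j k * (cornerInner p i j l - t * turn p i j l)
      + ε * turn p i j l * (t * turn p i j k - cornerInner p i j k)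
      + ε * turn p i l k * (cornerInner p i l j - s * turn p i l j)
      + ε * turn p i j l * (cornerInner p i l k - s * turn p i l k) = 0 := by
    unfold turn cornerInner
    ring
  have p1 := mul_pos hjk (sub_pos.2 h1)
  have p2 := mul_pos hlk (sub_pos.2 h2)
  have p3 := mul_pos hjl (sub_pos.2 h3)
  rw [htk] at e1
  linarith

/-- A nonempty set of neighbours of a site that is closed under going to the next neighbour on
either side contains all neighbours. -/
lemma mem_of_closed (hp : GeneralPosition p) {i : Fin n} {S : Finset (Fin n)}
    (hne : S.Nonempty) (hS : ∀ j ∈ S, Neighbors p i j)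
    (hnext : ∀ ε : ℝ, ε = 1 ∨ ε = -1 → ∀ j ∈ S, ∀ k, IsNext p ε i j (some k) → k ∈ S)
    {l : Fin n} (hl : Neighbors p i l) : l ∈ S := by
  classical
  by_contra hlS
  obtain ⟨ε, hε, j₀, hj₀, hpos₀⟩ :
      ∃ ε : ℝ, (ε = 1 ∨ ε = -1) ∧ ∃ j ∈ S, 0 < ε * turn p i j l := by
    obtain ⟨j, hj⟩ := hne
    have hjl : j ≠ l := fun h => hlS (h ▸ hj)
    rcases lt_or_gt_of_ne (hp.turn_ne_zero (hS j hj).1 hl.1 hjl) with h | h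
    · exact ⟨-1, Or.inr rfl, j, hj, by linarith⟩
    · exact ⟨1, Or.inl rfl, j, hj, by linarith⟩
  let dot : Fin n → ℝ := fun j =>
    (p j 0 - p i 0) * (p l 0 - p i 0) + (p j 1 - p i 1) * (p l 1 - p i 1)
  -- The quotient is the cotangent of the angle at `p i` from `p j` to `p l` in the direction `ε`.
  -- Maximizing it selects the member of `S` that is last before `l`; its successor `k` cannot jump
  -- over the neighbour `l`, so it would be even closer.
  obtain ⟨j, hj, hmax⟩ := Finset.exists_max_image (S.filter fun j => 0 < ε * turn p i j l)
    (fun j => dot j / (ε * turn p i j l)) ⟨j₀, by simp [hj₀, hpos₀]⟩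
  rw [Finset.mem_filter] at hj
  obtain ⟨hjS, hjl⟩ := hj
  have hjl' : j ≠ l := fun h => hlS (h ▸ hjS)
  obtain ⟨o, ho⟩ := exists_isNext p ε i j
  match o, ho with
  | none, ho => exact absurd (ho l hl.1.symm hjl'.symm) (not_le.2 hjl)
  | some k, ho =>
    have hkS := hnext ε hε j hjS k ho
    have hkl : k ≠ l := fun h => hlS (h ▸ hkS)
    have hnot : ¬ 0 < ε * turn p i l k := fun h =>
      (ho.emptyCircle hp hε (hS j hjS)).not_neighbors_between hp (hS j hjS).1 ho.1.symm
        ho.2.2.1 hjl h hl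
    have hkl' : 0 < ε * turn p i k l := by
      have h0 : ε * turn p i k l ≠ 0 :=
        mul_ne_zero (by rcases hε with rfl | rfl <;> norm_num)
          (hp.turn_ne_zero ho.1.symm hl.1 hkl)
      have h1 : 0 ≤ ε * turn p i k l := by rw [turn_swap]; linarith
      exact lt_of_le_of_ne h1 h0.symm
    have hle := hmax k (by simp [hkS, hkl'])
    rw [div_le_div_iff₀ hkl' hjl] at hle
    -- The cotangents of `k` and `j` compared with denominators cleared: the difference is positive
    -- since `k` is strictly past `j`.
    have hid : dot k * (ε * turn p i j l) - dot j * (ε * turn p i k l) =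
        ε * turn p i j k * sqDist (p l) (p i) := by
      simp only [dot, turn, sqDist]
      ring
    have := mul_pos ho.2.2.1 (sqDist_pos (hp.ne hl.1.symm))
    linarith

/-! ### The number of Voronoi edges is linear -/

lemma EmptyCircle.rotate {i j k : Fin n} {x : Plane} (h : EmptyCircle p i j k x) :
    EmptyCircle p j k i x :=
  ⟨h.2.1.trans h.1.symm, h.1.symm, fun l h1 h2 h3 => h.1 ▸ h.2.2 l h3 h1 h2⟩

lemma EmptyCircle.le {i j k : Fin n} {x : Plane} (h : EmptyCircle p i j k x) (l : Fin n) :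
    sqDist x (p i) ≤ sqDist x (p l) := by
  by_cases h1 : l = i
  · rw [h1]
  by_cases h2 : l = j
  · rw [h2, h.1]
  by_cases h3 : l = k
  · rw [h3, h.2.1]
  exact (h.2.2 l h1 h2 h3).le

lemma EmptyCircle.mem_of_le {i j k l : Fin n} {x : Plane} (h : EmptyCircle p i j k x)
    (hl : sqDist x (p l) ≤ sqDist x (p i)) : l ∈ ({i, j, k} : Finset (Fin n)) := by
  by_contra hne
  simp only [Finset.mem_insert, Finset.mem_singleton, not_or] at hne
  exact absurd (h.2.2 l hne.1 hne.2.1 hne.2.2) (not_lt.2 hl)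

/-- Some direction is not parallel to any line through two sites. -/
lemma exists_injective_projection (hp : Function.Injective p) :
    ∃ δ : ℝ, Function.Injective fun i => p i 0 + δ * p i 1 := by
  have hfin : (⋃ i : Fin n, ⋃ j : Fin n,
      {δ : ℝ | i ≠ j ∧ p i 0 + δ * p i 1 = p j 0 + δ * p j 1}).Finite := by
    -- Each pair of distinct sites forbids at most one slope.
    refine Set.finite_iUnion fun i => Set.finite_iUnion fun j => Set.Subsingleton.finite ?_
    rintro a ⟨hij, ha⟩ b ⟨-, hb⟩
    by_contra hab
    have h1 : (a - b) * (p i 1 - p j 1) = 0 := by linear_combination ha - hb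
    have h2 : p i 1 = p j 1 :=
      sub_eq_zero.1 ((mul_eq_zero.1 h1).resolve_left (sub_ne_zero.2 hab))
    have h3 : p i 0 = p j 0 := by rw [h2] at ha; linarith
    exact hij (hp (plane_ext h3 h2))
  obtain ⟨δ, hδ⟩ := hfin.infinite_compl.nonempty
  refine ⟨δ, fun i j hij => ?_⟩
  by_contra hne
  exact hδ (Set.mem_iUnion.2 ⟨i, Set.mem_iUnion.2 ⟨j, hne, hij⟩⟩)

/-- The sign that a Boolean stands for. -/
def boolSign (s : Bool) : ℝ := if s then 1 else -1

/-- The point `x` is the only extreme point, in the direction `(-δ, 1)` or its opposite, of the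
Voronoi cell of the site `p b`. -/
def IsCellExtreme (p : Fin n → Plane) (δ : ℝ) (b : Fin n) (s : Bool) (x : Plane) : Prop :=
  (∀ l, sqDist x (p b) ≤ sqDist x (p l)) ∧
  ∀ y : Plane, (∀ l, sqDist y (p b) ≤ sqDist y (p l)) → y ≠ x →
    boolSign s * (y 1 - δ * y 0) < boolSign s * (x 1 - δ * x 0)

lemma IsCellExtreme.unique {δ : ℝ} {b : Fin n} {s : Bool} {x y : Plane}
    (hx : IsCellExtreme p δ b s x) (hy : IsCellExtreme p δ b s y) : x = y := by
  by_contra hne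
  exact lt_asymm (hx.2 y hy.1 (Ne.symm hne)) (hy.2 x hx.1 hne)

/-- A Voronoi vertex is extreme in the cell of the middle one of its three sites. -/
lemma EmptyCircle.isCellExtreme_of_middle (hp : GeneralPosition p) {δ : ℝ} {a b c : Fin n}
    {x : Plane} (hba : b ≠ a) (hbc : b ≠ c) (hac : a ≠ c) (h : EmptyCircle p b a c x)
    (hmid : ((p a 0 + δ * p a 1) - (p b 0 + δ * p b 1)) *
      ((p c 0 + δ * p c 1) - (p b 0 + δ * p b 1)) < 0) :
    ∃ s, IsCellExtreme p δ b s x := by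
  have hturn : turn p b c a ≠ 0 := hp.turn_ne_zero hbc hba hac.symm
  set A := (p a 0 + δ * p a 1) - (p b 0 + δ * p b 1) with hA
  set C := (p c 0 + δ * p c 1) - (p b 0 + δ * p b 1) with hC
  have hC0 : C ≠ 0 := by rintro h0; rw [h0] at hmid; simp at hmid
  have key : ∀ y : Plane, (∀ l, sqDist y (p b) ≤ sqDist y (p l)) → y ≠ x →
      C * turn p b c a * ((y 1 - δ * y 0) - (x 1 - δ * x 0)) < 0 := by
    intro y hy hyx
    have ha := hy a
    have hc := hy c
    have ha' := h.1
    have hc' := h.2.1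
    set α := (y 0 - x 0) * (p a 0 - p b 0) + (y 1 - x 1) * (p a 1 - p b 1) with hα
    set γ := (y 0 - x 0) * (p c 0 - p b 0) + (y 1 - x 1) * (p c 1 - p b 1) with hγ
    have hα0 : α ≤ 0 := by
      unfold sqDist at ha ha'
      linarith
    have hγ0 : γ ≤ 0 := by
      unfold sqDist at hc hc'
      linarith
    -- Since `A` and `C` have opposite signs, `C ^ 2 * (p a - p b) - A * C * (p c - p b)` is a
    -- positive combination of the two outer normals of the cell at `x`. It is orthogonal to `(1,
    -- δ)`, hence a multiple of `(-δ, 1)`.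
    have hid : C * turn p b c a * ((y 1 - δ * y 0) - (x 1 - δ * x 0)) =
        C ^ 2 * α - A * C * γ := by
      simp only [hα, hγ, hA, hC, turn]
      ring
    rw [hid]
    have hC2 : 0 < C ^ 2 := by positivity
    have h1 : C ^ 2 * α ≤ 0 := mul_nonpos_of_nonneg_of_nonpos hC2.le hα0
    have h2 : 0 ≤ A * C * γ := mul_nonneg_of_nonpos_of_nonpos hmid.le hγ0
    by_contra! hge
    -- Equality would make `y - x` orthogonal to two linearly independent vectors.
    have hα1 : α = 0 := (mul_eq_zero.1 (by linarith : C ^ 2 * α = 0)).resolve_left hC2.ne'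
    have hγ1 : γ = 0 := (mul_eq_zero.1 (by linarith : A * C * γ = 0)).resolve_left hmid.ne
    apply hyx
    apply plane_ext
    · have : turn p b c a * (y 0 - x 0) = 0 := by
        unfold turn
        linear_combination (p a 1 - p b 1) * (hγ.symm.trans hγ1) -
          (p c 1 - p b 1) * (hα.symm.trans hα1)
      exact sub_eq_zero.1 ((mul_eq_zero.1 this).resolve_left hturn)
    · have : turn p b c a * (y 1 - x 1) = 0 := by
        unfold turn
        linear_combination (p c 0 - p b 0) * (hα.symm.trans hα1) -
          (p a 0 - p b 0) * (hγ.symm.trans hγ1)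
      exact sub_eq_zero.1 ((mul_eq_zero.1 this).resolve_left hturn)
  rcases lt_or_gt_of_ne (mul_ne_zero hC0 hturn) with hs | hs
  · refine ⟨false, h.le, fun y hy hyx => ?_⟩
    have := key y hy hyx
    simp only [boolSign, Bool.false_eq_true, if_false]
    nlinarith
  · refine ⟨true, h.le, fun y hy hyx => ?_⟩
    have := key y hy hyx
    simp only [boolSign, if_true]
    nlinarith

lemma exists_middle {a b c : ℝ} (hab : a ≠ b) (hbc : b ≠ c) (hac : a ≠ c) :
    (b - a) * (c - a) < 0 ∨ (c - b) * (a - b) < 0 ∨ (a - c) * (b - c) < 0 := by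
  by_contra! h
  rcases lt_or_gt_of_ne hab with h1 | h1 <;> rcases lt_or_gt_of_ne hbc with h2 | h2 <;>
    rcases lt_or_gt_of_ne hac with h3 | h3 <;> nlinarith [h.1, h.2.1, h.2.2]

lemma EmptyCircle.exists_isCellExtreme (hp : GeneralPosition p) {δ : ℝ}
    (hδ : Function.Injective fun i => p i 0 + δ * p i 1) {i j k : Fin n} {x : Plane}
    (hij : i ≠ j) (hik : i ≠ k) (hjk : j ≠ k) (h : EmptyCircle p i j k x) :
    ∃ b s, IsCellExtreme p δ b s x := by
  rcases exists_middle (hδ.ne hij) (hδ.ne hjk) (hδ.ne hik) with hm | hm | hm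
  · exact ⟨i, h.isCellExtreme_of_middle hp hij hik hjk hm⟩
  · exact ⟨j, h.rotate.isCellExtreme_of_middle hp hjk hij.symm hik.symm hm⟩
  · exact ⟨k, h.rotate.rotate.isCellExtreme_of_middle hp hik.symm hjk.symm hij hm⟩

open Classical in
/-- The Voronoi neighbours of the site `p i`. -/
noncomputable def neighborFinset (p : Fin n → Plane) (i : Fin n) : Finset (Fin n) :=
  Finset.univ.filter fun j => Neighbors p i j

lemma mem_neighborFinset {i j : Fin n} : j ∈ neighborFinset p i ↔ Neighbors p i j := by
  simp [neighborFinset]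

-- If `j` and `j'` both had all other sites on their right as seen from `i`, each would be to the
-- right of the other, against the antisymmetry of `turn`. So the first index determines the pair.
open Classical in
lemma card_unbounded_le (hp : GeneralPosition p) :
    (Finset.univ.filter fun q : Fin n × Fin n =>
      q.1 ≠ q.2 ∧ IsNext p 1 q.1 q.2 none).card ≤ n := by
  refine (Finset.card_le_card_of_injOn Prod.fst (fun _ _ => Finset.mem_univ _) ?_).trans_eq
    (Finset.card_fin n)
  rintro ⟨i, j⟩ h ⟨i', j'⟩ h' rfl
  simp only [Finset.coe_filter, Finset.mem_univ, true_and, Set.mem_ofPred_eq] at h h'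
  by_contra hne
  have hjj : j ≠ j' := fun hj => hne (by rw [hj])
  have h1 := h.2 j' h'.1.symm hjj.symm
  have h2 := h'.2 j h.1.symm hjj
  rw [turn_swap] at h2
  exact hp.turn_ne_zero h.1 h'.1 hjj (by linarith)

-- All circles in question share one centre, the unique extreme point, and hence the same three
-- sites. Both members of a pair are among these, which leaves `3 * 3` ordered pairs.
open Classical in
lemma card_bounded_le (δ : ℝ) (b : Fin n) (s : Bool) :
    (Finset.univ.filter fun q : Fin n × Fin n => ∃ k x, EmptyCircle p q.1 q.2 k x ∧
      IsCellExtreme p δ b s x).card ≤ 9 := by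
  rcases Finset.eq_empty_or_nonempty (Finset.univ.filter fun q : Fin n × Fin n =>
    ∃ k x, EmptyCircle p q.1 q.2 k x ∧ IsCellExtreme p δ b s x) with h | ⟨⟨i, j⟩, h⟩
  · rw [h]; simp
  · simp only [Finset.mem_filter, Finset.mem_univ, true_and] at h
    obtain ⟨k, x, hx, hex⟩ := h
    have hsub : (Finset.univ.filter fun q : Fin n × Fin n =>
        ∃ k x, EmptyCircle p q.1 q.2 k x ∧ IsCellExtreme p δ b s x) ⊆
        ({i, j, k} : Finset (Fin n)) ×ˢ ({i, j, k} : Finset (Fin n)) := by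
      rintro ⟨i', j'⟩ h'
      simp only [Finset.mem_filter, Finset.mem_univ, true_and] at h'
      obtain ⟨k', x', hx', hex'⟩ := h'
      obtain rfl := hex.unique hex'
      exact Finset.mem_product.2
        ⟨hx.mem_of_le (hx'.le i), hx.mem_of_le (hx'.1.le.trans (hx'.le i))⟩
    refine (Finset.card_le_card hsub).trans ?_
    rw [Finset.card_product]
    exact Nat.mul_le_mul Finset.card_le_three Finset.card_le_three

/-- The Voronoi cells have at most `19 * n` edges altogether. -/
theorem sum_card_neighborFinset_le (hp : GeneralPosition p) :
    ∑ i, (neighborFinset p i).card ≤ 19 * n := by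
  classical
  obtain ⟨δ, hδ⟩ := exists_injective_projection hp.1
  have hsum : ∑ i, (neighborFinset p i).card =
      (Finset.univ.filter fun q : Fin n × Fin n => Neighbors p q.1 q.2).card := by
    simp only [neighborFinset, Finset.card_filter, Fintype.sum_prod_type]
  rw [hsum]
  -- An ordered pair of neighbours is charged by the left end of its edge: at most `n` pairs are
  -- unbounded there, and each of the `2 * n` combinations of a cell and a sign accounts for at most
  -- `9` others.
  have hsub : (Finset.univ.filter fun q : Fin n × Fin n => Neighbors p q.1 q.2) ⊆
      (Finset.univ.filter fun q : Fin n × Fin n => q.1 ≠ q.2 ∧ IsNext p 1 q.1 q.2 none) ∪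
      (Finset.univ : Finset (Fin n × Bool)).biUnion fun c =>
        Finset.univ.filter fun q : Fin n × Fin n => ∃ k x, EmptyCircle p q.1 q.2 k x ∧
          IsCellExtreme p δ c.1 c.2 x := by
    rintro ⟨i, j⟩ h
    simp only [Finset.mem_filter, Finset.mem_univ, true_and] at h
    simp only [Finset.mem_union, Finset.mem_biUnion, Finset.mem_filter, Finset.mem_univ, true_and]
    obtain ⟨o, ho⟩ := exists_isNext p 1 i j
    match o, ho with
    | none, ho => exact Or.inl ⟨h.1, ho⟩
    | some k, ho =>
      have he := ho.emptyCircle hp (Or.inl rfl) h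
      obtain ⟨b, s, hb⟩ := he.exists_isCellExtreme hp hδ h.1 ho.1.symm ho.2.1.symm
      exact Or.inr ⟨(b, s), k, _, he, hb⟩
  have h1 := Finset.card_le_card hsub
  have h2 := Finset.card_biUnion_le_card_mul (Finset.univ : Finset (Fin n × Bool))
    (fun c => Finset.univ.filter fun q : Fin n × Fin n => ∃ k x, EmptyCircle p q.1 q.2 k x ∧
      IsCellExtreme p δ c.1 c.2 x) 9 (fun c _ => card_bounded_le δ c.1 c.2)
  have h3 := card_unbounded_le hp
  have h4 : (Finset.univ : Finset (Fin n × Bool)).card = n * 2 := by simp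
  rw [h4] at h2
  have h5 := Finset.card_union_le
    (Finset.univ.filter fun q : Fin n × Fin n => q.1 ≠ q.2 ∧ IsNext p 1 q.1 q.2 none)
    ((Finset.univ : Finset (Fin n × Bool)).biUnion fun c =>
        Finset.univ.filter fun q : Fin n × Fin n => ∃ k x, EmptyCircle p q.1 q.2 k x ∧
          IsCellExtreme p δ c.1 c.2 x)
  omega

/-! ### Edge reports -/

/-- The endpoint of the edge of `p i` and `p j` that is determined by the bounding site. -/
noncomputable def endpoint (p : Fin n → Plane) (i j : Fin n) (o : Option (Fin n)) :
    Option Plane :=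
  o.map fun k => bisectorPoint p i j (centerParam p i j k)

/-- The report of the edge of `p i` and `p j` with the given bounding sites. -/
noncomputable def edgeReport (p : Fin n → Plane) (i j : Fin n) (l r : Option (Fin n)) :
    EdgeReport n :=
  ⟨i, j, endpoint p i j l, endpoint p i j r⟩

/-- The parameter increases to the left as seen from `p i` towards `p j`; this matches `ε = 1` with
the left endpoint. -/
lemma inner_bisectorPoint_sub (i j : Fin n) (s t : ℝ) :
    inner ℝ (bisectorPoint p i j s - bisectorPoint p i j t) (rotLeft (p j - p i)) =
      (s - t) * (sqDist (p j) (p i) / 2) := by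
  simp only [PiLp.inner_apply, Fin.sum_univ_two, PiLp.sub_apply, bisectorPoint_zero,
    bisectorPoint_one, rotLeft, sqDist, RCLike.inner_apply, conj_trivial]
  simp
  ring

lemma inner_bisectorPoint_sub_pos_iff (hp : GeneralPosition p) {i j : Fin n} (hij : i ≠ j)
    (s t : ℝ) : 0 < inner ℝ (bisectorPoint p i j s - bisectorPoint p i j t)
      (rotLeft (p j - p i)) ↔ t < s := by
  rw [inner_bisectorPoint_sub, mul_pos_iff_of_pos_right
    (half_pos (sqDist_pos (hp.ne hij.symm))), sub_pos]

/-- Dividing `t * turn p i j k < cornerInner p i j k` by `turn` gives an upper bound for `t` if `k`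
is on the left and a lower bound if it is on the right. Only the tightest bound on each side
matters. -/
theorem edgeReport_correct (hp : GeneralPosition p) {i j : Fin n} (hlt : i < j)
    (hij : Neighbors p i j) {l r : Option (Fin n)} (hl : IsNext p 1 i j l)
    (hr : IsNext p (-1) i j r) : (edgeReport p i j l r).Correct p := by
  have hmem : ∀ o, ∀ a ∈ endpoint p i j o, a ∈ AffineSubspace.perpBisector (p i) (p j) := by
    intro o a ha
    obtain ⟨k, -, rfl⟩ := Option.map_eq_some_iff.1 ha
    exact bisectorPoint_mem_perpBisector _ _ _
  refine ⟨hlt, hmem l, hmem r, (voronoiEdge_nonempty_iff hp hij.1).2 hij, ?_⟩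
  have hpt : ∀ t, bisectorPoint p i j t ∈ (edgeReport p i j l r).points p ↔
      (∀ k ∈ l, t < centerParam p i j k) ∧ (∀ k ∈ r, centerParam p i j k < t) := by
    intro t
    simp only [EdgeReport.points, edgeReport, endpoint, Set.mem_ofPred_eq,
      bisectorPoint_mem_perpBisector, true_and, Option.mem_def, Option.map_eq_some_iff,
      forall_exists_index, and_imp, forall_apply_eq_imp_iff₂,
      inner_bisectorPoint_sub_pos_iff hp hij.1]
  have hsame : ∀ t, bisectorPoint p i j t ∈ (edgeReport p i j l r).points p ↔
      bisectorPoint p i j t ∈ voronoiEdge p i j := by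
    intro t
    rw [hpt, bisectorPoint_mem_voronoiEdge_iff]
    have hiff : ∀ k, k ≠ i → k ≠ j → (t * turn p i j k < cornerInner p i j k ↔
        (0 < turn p i j k → t < centerParam p i j k) ∧
        (turn p i j k < 0 → centerParam p i j k < t)) := by
      intro k hki hkj
      rcases lt_or_gt_of_ne (hp.turn_ne_zero hij.1 hki.symm hkj.symm) with h | h
      · simp [h, h.not_gt, centerParam, div_lt_iff_of_neg]
      · simp [h, h.not_gt, centerParam, lt_div_iff₀]
    constructor
    · rintro ⟨h1, h2⟩ k hki hkj
      refine (hiff k hki hkj).2 ⟨fun hc => ?_, fun hc => ?_⟩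
      · match l, hl with
        | none, hl => exact absurd (hl k hki hkj) (by linarith)
        | some a, hl =>
          have := hl.2.2.2 k hki hkj (by linarith)
          have := h1 a rfl
          linarith
      · match r, hr with
        | none, hr => exact absurd (hr k hki hkj) (by linarith)
        | some a, hr =>
          have := hr.2.2.2 k hki hkj (by linarith)
          have := h2 a rfl
          linarith
    · intro h
      constructor
      · rintro k rfl
        exact ((hiff k hl.1 hl.2.1).1 (h k hl.1 hl.2.1)).1 (by linarith [hl.2.2.1])
      · rintro k rfl
        exact ((hiff k hr.1 hr.2.1).1 (h k hr.1 hr.2.1)).2 (by linarith [hr.2.2.1])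
  ext x
  constructor
  · intro hx
    obtain ⟨t, rfl⟩ := exists_eq_bisectorPoint (hp.ne hij.1) ((dist_eq_dist_iff_sqDist _ _ _ _).1
      (AffineSubspace.mem_perpBisector_iff_dist_eq.1 hx.1))
    exact (hsame t).1 hx
  · intro hx
    obtain ⟨t, rfl⟩ := exists_eq_bisectorPoint_of_mem_voronoiEdge (hp.ne hij.1) hx
    exact (hsame t).2 hx

/-! ### Walks around a Voronoi cell -/

/-- The neighbours in `S` are consecutive around the cell of `p i`, from `first` to `last` in the
direction given by `ε`. -/
structure IsWalk (p : Fin n → Plane) (ε : ℝ) (i : Fin n) (S : Finset (Fin n))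
    (first last : Fin n) : Prop where
  first_mem : first ∈ S
  last_mem : last ∈ S
  neighbors : ∀ a ∈ S, Neighbors p i a
  next : ∀ a ∈ S, a ≠ last → ∃ b ∈ S, b ≠ first ∧ IsNext p ε i a (some b)
  prev : ∀ a ∈ S, a ≠ first → ∃ b ∈ S, b ≠ last ∧ IsNext p (-ε) i a (some b)

lemma IsWalk.singleton {ε : ℝ} {i j : Fin n} (h : Neighbors p i j) :
    IsWalk p ε i {j} j j where
  first_mem := by simp
  last_mem := by simp
  neighbors a ha := by rwa [Finset.mem_singleton.1 ha]
  next a ha hne := absurd (Finset.mem_singleton.1 ha) hne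
  prev a ha hne := absurd (Finset.mem_singleton.1 ha) hne

lemma IsWalk.reverse {ε : ℝ} {i : Fin n} {S : Finset (Fin n)} {first last : Fin n}
    (h : IsWalk p ε i S first last) : IsWalk p (-ε) i S last first where
  first_mem := h.last_mem
  last_mem := h.first_mem
  neighbors := h.neighbors
  next := h.prev
  prev := by rw [neg_neg]; exact h.next

lemma IsNext.symm (hp : GeneralPosition p) {ε : ℝ} (hε : ε = 1 ∨ ε = -1)
    {i j k : Fin n} (hij : Neighbors p i j) (h : IsNext p ε i j (some k)) :
    IsNext p (-ε) i k (some j) := by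
  obtain ⟨o, ho⟩ := exists_isNext p (-ε) i k
  rwa [h.reverse hp hε hij ho] at ho

/-- A member other than `first` has a predecessor in the walk different from `last`, whereas by
reversibility the predecessor of `k` is `last`. So a walk meets new sites until it closes up at
`first`. -/
lemma IsWalk.not_mem_of_isNext (hp : GeneralPosition p) {ε : ℝ} (hε : ε = 1 ∨ ε = -1)
    {i : Fin n} {S : Finset (Fin n)} {first last k : Fin n} (h : IsWalk p ε i S first last)
    (hk : IsNext p ε i last (some k)) (hne : k ≠ first) : k ∉ S := by
  intro hkS
  obtain ⟨b, -, hb, hkb⟩ := h.prev k hkS hne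
  have := hk.reverse hp hε (h.neighbors _ h.last_mem) hkb
  exact hb (Option.some_injective _ this)

lemma IsWalk.insert (hp : GeneralPosition p) {ε : ℝ} (hε : ε = 1 ∨ ε = -1)
    {i : Fin n} {S : Finset (Fin n)} {first last k : Fin n} (h : IsWalk p ε i S first last)
    (hk : IsNext p ε i last (some k)) (hne : k ≠ first) :
    IsWalk p ε i (insert k S) first k := by
  have hkS := h.not_mem_of_isNext hp hε hk hne
  have hlast := h.neighbors _ h.last_mem
  refine ⟨Finset.mem_insert_of_mem h.first_mem, Finset.mem_insert_self _ _, ?_, ?_, ?_⟩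
  · intro a ha
    rcases Finset.mem_insert.1 ha with rfl | ha
    · exact hk.neighbors hp hε hlast
    · exact h.neighbors a ha
  · intro a ha hak
    have ha := Finset.mem_of_mem_insert_of_ne ha hak
    by_cases hal : a = last
    · subst hal
      exact ⟨k, Finset.mem_insert_self _ _, hne, hk⟩
    · obtain ⟨b, hb, hb1, hb2⟩ := h.next a ha hal
      exact ⟨b, Finset.mem_insert_of_mem hb, hb1, hb2⟩
  · intro a ha haf
    rcases Finset.mem_insert.1 ha with rfl | ha
    · exact ⟨last, Finset.mem_insert_of_mem h.last_mem, fun h' => hkS (h' ▸ h.last_mem),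
        hk.symm hp hε hlast⟩
    · obtain ⟨b, hb, hb1, hb2⟩ := h.prev a ha haf
      exact ⟨b, Finset.mem_insert_of_mem hb, fun h' => hkS (h' ▸ hb), hb2⟩

/-- Successors are unique, so inside a walk they are members already and the closure required by the
set version of `mem_of_closed` has to be checked at the two ends only. -/
lemma IsWalk.mem_of_ends (hp : GeneralPosition p) {ε : ℝ} (hε : ε = 1 ∨ ε = -1)
    {i : Fin n} {S : Finset (Fin n)} {first last : Fin n} (h : IsWalk p ε i S first last)
    (hlast : ∀ k, IsNext p ε i last (some k) → k ∈ S)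
    (hfirst : ∀ k, IsNext p (-ε) i first (some k) → k ∈ S)
    {l : Fin n} (hl : Neighbors p i l) : l ∈ S := by
  have hε' := neg_sign hε
  have h1 : ∀ j ∈ S, ∀ k, IsNext p ε i j (some k) → k ∈ S := by
    intro j hj k hk
    by_cases hjl : j = last
    · exact hlast k (hjl ▸ hk)
    · obtain ⟨b, hb, -, hjb⟩ := h.next j hj hjl
      rwa [Option.some_injective _ (hk.unique hp hε (h.neighbors j hj) hjb)]
  have h2 : ∀ j ∈ S, ∀ k, IsNext p (-ε) i j (some k) → k ∈ S := by
    intro j hj k hk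
    by_cases hjl : j = first
    · exact hfirst k (hjl ▸ hk)
    · obtain ⟨b, hb, -, hjb⟩ := h.prev j hj hjl
      rwa [Option.some_injective _ (hk.unique hp hε' (h.neighbors j hj) hjb)]
  refine mem_of_closed hp ⟨first, h.first_mem⟩ h.neighbors (fun η hη => ?_) hl
  rcases hε with rfl | rfl <;> rcases hη with rfl | rfl
  · exact h1
  · exact h2
  · rw [neg_neg] at h2
    exact h2
  · exact h1

/-- A walk that comes back to its start has met all neighbours. -/
lemma IsWalk.mem_of_closed (hp : GeneralPosition p) {ε : ℝ} (hε : ε = 1 ∨ ε = -1)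
    {i : Fin n} {S : Finset (Fin n)} {first last : Fin n} (h : IsWalk p ε i S first last)
    (hlast : IsNext p ε i last (some first)) {l : Fin n} (hl : Neighbors p i l) : l ∈ S := by
  refine h.mem_of_ends hp hε (fun k hk => ?_) (fun k hk => ?_) hl
  · rw [Option.some_injective _ (hk.unique hp hε (h.neighbors _ h.last_mem) hlast)]
    exact h.first_mem
  · rw [Option.some_injective _ (hlast.reverse hp hε (h.neighbors _ h.last_mem) hk)]
    exact h.last_mem

/-- A walk that cannot be extended at either end has met all neighbours. -/
lemma IsWalk.mem_of_unbounded (hp : GeneralPosition p) {ε : ℝ} (hε : ε = 1 ∨ ε = -1)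
    {i : Fin n} {S : Finset (Fin n)} {first last : Fin n} (h : IsWalk p ε i S first last)
    (hlast : IsNext p ε i last none) (hfirst : IsNext p (-ε) i first none)
    {l : Fin n} (hl : Neighbors p i l) : l ∈ S := by
  refine h.mem_of_ends hp hε (fun k hk => ?_) (fun k hk => ?_) hl
  · exact absurd (hlast k hk.1 hk.2.1) (not_le.2 hk.2.2.1)
  · exact absurd (hfirst k hk.1 hk.2.1) (not_le.2 hk.2.2.1)

/-- A walk whose start is unbounded does not come back to its start. -/
lemma IsWalk.ne_first (hp : GeneralPosition p) {ε : ℝ} (hε : ε = 1 ∨ ε = -1)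
    {i : Fin n} {S : Finset (Fin n)} {first last k : Fin n} (h : IsWalk p ε i S first last)
    (hk : IsNext p ε i last (some k)) (hfirst : IsNext p (-ε) i first none) : k ≠ first := by
  rintro rfl
  exact absurd (hk.reverse hp hε (h.neighbors _ h.last_mem) hfirst) (by simp)

/-! ### Lists of reports -/

/-- The stream `out` lists the Voronoi edges of the pairs in `V` whose first index is the smaller
one. -/
def Reported (p : Fin n → Plane) (V : Fin n × Fin n → Prop) (out : List OutWord) : Prop :=
  ∃ L : List (EdgeReport n),
    out = L.flatMap EdgeReport.encode ∧
    (L.map fun e => (e.fst, e.snd)).Nodup ∧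
    (∀ e ∈ L, e.Correct p ∧ V (e.fst, e.snd)) ∧
    (∀ i j : Fin n, i < j → V (i, j) → ∃ e ∈ L, e.fst = i ∧ e.snd = j)

lemma Reported.congr {V W : Fin n × Fin n → Prop} {out : List OutWord} (h : Reported p V out)
    (hVW : ∀ q, V q ↔ W q) : Reported p W out := by
  rwa [← show V = W from funext fun q => propext (hVW q)]

/-- Treating a pair in decreasing order writes nothing; the edge is reported from its other cell. -/
lemma Reported.skip {V W : Fin n × Fin n → Prop} {out : List OutWord} (h : Reported p V out)
    {i j : Fin n} (hij : ¬ i < j) (hW : ∀ q, W q ↔ q = (i, j) ∨ V q) : Reported p W out := by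
  obtain ⟨L, hout, hnd, hL, hV⟩ := h
  refine ⟨L, hout, hnd, fun e he => ⟨(hL e he).1, (hW _).2 (Or.inr (hL e he).2)⟩, ?_⟩
  intro a b hab hq
  rcases (hW _).1 hq with h | h
  · obtain ⟨rfl, rfl⟩ := Prod.mk.inj h
    exact absurd hab hij
  · exact hV a b hab h

lemma Reported.append {V W : Fin n × Fin n → Prop} {out : List OutWord} (h : Reported p V out)
    {e : EdgeReport n} (he : e.Correct p) (hV : ¬ V (e.fst, e.snd))
    (hW : ∀ q, W q ↔ q = (e.fst, e.snd) ∨ V q) : Reported p W (out ++ e.encode) := by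
  obtain ⟨L, rfl, hnd, hL, hV'⟩ := h
  refine ⟨L ++ [e], by simp, ?_, ?_, ?_⟩
  · rw [List.map_append, List.nodup_append]
    refine ⟨hnd, by simp, ?_⟩
    intro a ha b hb
    obtain ⟨e', he', rfl⟩ := List.mem_map.1 ha
    simp only [List.map_cons, List.map_nil, List.mem_singleton] at hb
    rintro rfl
    exact hV (hb ▸ (hL e' he').2)
  · intro e' he'
    rcases List.mem_append.1 he' with h | h
    · exact ⟨(hL e' h).1, (hW _).2 (Or.inr (hL e' h).2)⟩
    · rw [List.mem_singleton.1 h]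
      exact ⟨he, (hW _).2 (Or.inl rfl)⟩
  · intro i j hij hq
    rcases (hW _).1 hq with h | h
    · obtain ⟨rfl, rfl⟩ := Prod.mk.inj h
      exact ⟨e, by simp, rfl, rfl⟩
    · obtain ⟨e', he', h1⟩ := hV' i j hij h
      exact ⟨e', List.mem_append_left _ he', h1⟩

/-- The pairs that have been treated when the cells of the first `m` sites are finished and the
neighbours in `S` of the next site have been visited. -/
def Treated (p : Fin n → Plane) (m : ℕ) (S : Finset (Fin n)) (q : Fin n × Fin n) : Prop :=
  ((q.1 : ℕ) < m ∧ Neighbors p q.1 q.2) ∨ ((q.1 : ℕ) = m ∧ q.2 ∈ S)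

lemma treated_insert {i j : Fin n} {S : Finset (Fin n)} (q : Fin n × Fin n) :
    Treated p i (insert j S) q ↔ q = (i, j) ∨ Treated p i S q := by
  obtain ⟨a, b⟩ := q
  simp only [Treated, Finset.mem_insert, Prod.mk.injEq, Fin.ext_iff]
  tauto

lemma not_treated {i j : Fin n} {S : Finset (Fin n)} (hj : j ∉ S) : ¬ Treated p i S (i, j) := by
  simp [Treated, hj]

lemma treated_succ {i : Fin n} {S : Finset (Fin n)} (hS : ∀ l, l ∈ S ↔ Neighbors p i l)
    (q : Fin n × Fin n) : Treated p i S q ↔ Treated p ((i : ℕ) + 1) ∅ q := by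
  obtain ⟨a, b⟩ := q
  simp only [Treated, hS, Finset.notMem_empty, and_false, or_false, Nat.lt_succ_iff_lt_or_eq]
  constructor
  · rintro (h | ⟨h, h'⟩)
    · exact ⟨Or.inl h.1, h.2⟩
    · obtain rfl := Fin.ext h
      exact ⟨Or.inr rfl, h'⟩
  · rintro ⟨h | h, h'⟩
    · exact Or.inl ⟨h, h'⟩
    · obtain rfl := Fin.ext h
      exact Or.inr ⟨rfl, h'⟩

lemma Reported.reportsVoronoiEdges (hp : GeneralPosition p) {out : List OutWord}
    (h : Reported p (Treated p n ∅) out) : ReportsVoronoiEdges p out := by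
  obtain ⟨L, hout, hnd, hL, hV⟩ := h
  refine ⟨L, hout, hnd, fun e he => (hL e he).1, fun i j hij hne => hV i j hij ?_⟩
  exact Or.inl ⟨i.2, (voronoiEdge_nonempty_iff hp hij.ne).1 hne⟩

/-! ### Scanning for the next site -/

/-- The site `o` is the best candidate among the first `K` sites for bounding the edge of `p i`
and `p j` on the side `ε`. -/
def IsBest (p : Fin n → Plane) (ε : ℝ) (i j : Fin n) (K : ℕ) : Option (Fin n) → Prop
  | none => ∀ k : Fin n, (k : ℕ) < K → k ≠ i → k ≠ j → ε * turn p i j k ≤ 0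
  | some k => k ≠ i ∧ k ≠ j ∧ 0 < ε * turn p i j k ∧
      ∀ l : Fin n, (l : ℕ) < K → l ≠ i → l ≠ j → 0 < ε * turn p i j l →
        ε * centerParam p i j k ≤ ε * centerParam p i j l

lemma isBest_zero (ε : ℝ) (i j : Fin n) : IsBest p ε i j 0 none :=
  fun _ h => absurd h (Nat.not_lt_zero _)

lemma IsBest.isNext {ε : ℝ} {i j : Fin n} {o : Option (Fin n)} (h : IsBest p ε i j n o) :
    IsNext p ε i j o := by
  match o, h with
  | none, h => exact fun k => h k k.2
  | some k, h => exact ⟨h.1, h.2.1, h.2.2.1, fun l => h.2.2.2 l l.2⟩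

lemma IsBest.keep {ε : ℝ} {i j k : Fin n} {o : Option (Fin n)} (h : IsBest p ε i j k o)
    (hk : k ≠ i → k ≠ j → 0 < ε * turn p i j k →
      ∃ b ∈ o, ε * centerParam p i j b ≤ ε * centerParam p i j k) :
    IsBest p ε i j ((k : ℕ) + 1) o := by
  match o, h with
  | none, h =>
    intro l hl hli hlj
    rcases Nat.lt_succ_iff_lt_or_eq.1 hl with hl | hl
    · exact h l hl hli hlj
    · obtain rfl := Fin.ext hl
      by_contra! hpos
      obtain ⟨b, hb, -⟩ := hk hli hlj hpos
      simp at hb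
  | some b, h =>
    refine ⟨h.1, h.2.1, h.2.2.1, fun l hl hli hlj hpos => ?_⟩
    rcases Nat.lt_succ_iff_lt_or_eq.1 hl with hl | hl
    · exact h.2.2.2 l hl hli hlj hpos
    · obtain rfl := Fin.ext hl
      obtain ⟨b', hb', hle⟩ := hk hli hlj hpos
      obtain rfl := Option.some_injective _ hb'
      exact hle

lemma IsBest.replace {ε : ℝ} {i j k : Fin n} {o : Option (Fin n)} (h : IsBest p ε i j k o)
    (hki : k ≠ i) (hkj : k ≠ j) (hpos : 0 < ε * turn p i j k)
    (hk : ∀ b ∈ o, ε * centerParam p i j k ≤ ε * centerParam p i j b) :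
    IsBest p ε i j ((k : ℕ) + 1) (some k) := by
  refine ⟨hki, hkj, hpos, fun l hl hli hlj hl0 => ?_⟩
  rcases Nat.lt_succ_iff_lt_or_eq.1 hl with hl | hl
  · match o, h with
    | none, h => exact absurd (h l hl hli hlj) (not_le.2 hl0)
    | some b, h => exact (hk b rfl).trans (h.2.2.2 l hl hli hlj hl0)
  · obtain rfl := Fin.ext hl
    exact le_rfl

/-- The site `o` is nearest to `p i` among the other ones of the first `K` sites. -/
def IsNearest (p : Fin n → Plane) (i : Fin n) (K : ℕ) : Option (Fin n) → Prop
  | none => ∀ k : Fin n, (k : ℕ) < K → k = i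
  | some j => i ≠ j ∧ ∀ k : Fin n, (k : ℕ) < K → k ≠ i → sqDist (p j) (p i) ≤ sqDist (p k) (p i)

lemma isNearest_zero (i : Fin n) : IsNearest p i 0 none :=
  fun _ h => absurd h (Nat.not_lt_zero _)

lemma IsNearest.keep {i k : Fin n} {o : Option (Fin n)} (h : IsNearest p i k o)
    (hk : k ≠ i → ∃ b ∈ o, sqDist (p b) (p i) ≤ sqDist (p k) (p i)) :
    IsNearest p i ((k : ℕ) + 1) o := by
  match o, h with
  | none, h =>
    intro l hl
    rcases Nat.lt_succ_iff_lt_or_eq.1 hl with hl | hl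
    · exact h l hl
    · obtain rfl := Fin.ext hl
      by_contra! hne
      obtain ⟨b, hb, -⟩ := hk hne
      simp at hb
  | some b, h =>
    refine ⟨h.1, fun l hl hli => ?_⟩
    rcases Nat.lt_succ_iff_lt_or_eq.1 hl with hl | hl
    · exact h.2 l hl hli
    · obtain rfl := Fin.ext hl
      obtain ⟨b', hb', hle⟩ := hk hli
      obtain rfl := Option.some_injective _ hb'
      exact hle

lemma IsNearest.replace {i k : Fin n} {o : Option (Fin n)} (h : IsNearest p i k o) (hki : k ≠ i)
    (hk : ∀ b ∈ o, sqDist (p k) (p i) ≤ sqDist (p b) (p i)) :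
    IsNearest p i ((k : ℕ) + 1) (some k) := by
  refine ⟨hki.symm, fun l hl hli => ?_⟩
  rcases Nat.lt_succ_iff_lt_or_eq.1 hl with hl | hl
  · match o, h with
    | none, h => exact absurd (h l hl) hli
    | some b, h => exact (hk b rfl).trans (h.2 l hl hli)
  · obtain rfl := Fin.ext hl
    exact le_rfl

/-! ### What fits into a real cell -/

/-- Rational expressions with integer constants in the six coordinates of three sites. -/
inductive RatExpr : Type
  | var (t : Fin 6)
  | const (z : ℤ)
  | add (e f : RatExpr)
  | sub (e f : RatExpr)
  | mul (e f : RatExpr)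
  | div (e f : RatExpr)

namespace RatExpr

/-- The value of an expression. -/
noncomputable def eval (ρ : Fin 6 → ℝ) : RatExpr → ℝ
  | var t => ρ t
  | const z => z
  | add e f => e.eval ρ + f.eval ρ
  | sub e f => e.eval ρ - f.eval ρ
  | mul e f => e.eval ρ * f.eval ρ
  | div e f => e.eval ρ / f.eval ρ

/-- No division by zero occurs in the evaluation of the expression. -/
def Defined (ρ : Fin 6 → ℝ) : RatExpr → Prop
  | var _ => True
  | const _ => True
  | add e f => e.Defined ρ ∧ f.Defined ρ
  | sub e f => e.Defined ρ ∧ f.Defined ρ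
  | mul e f => e.Defined ρ ∧ f.Defined ρ
  | div e f => e.Defined ρ ∧ f.Defined ρ ∧ f.eval ρ ≠ 0

/-- Numerator and denominator of an expression. -/
noncomputable def frac : RatExpr → MvPolynomial (Fin 6) ℤ × MvPolynomial (Fin 6) ℤ
  | var t => (MvPolynomial.X t, 1)
  | const z => (MvPolynomial.C z, 1)
  | add e f => (e.frac.1 * f.frac.2 + f.frac.1 * e.frac.2, e.frac.2 * f.frac.2)
  | sub e f => (e.frac.1 * f.frac.2 - f.frac.1 * e.frac.2, e.frac.2 * f.frac.2)
  | mul e f => (e.frac.1 * f.frac.1, e.frac.2 * f.frac.2)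
  | div e f => (e.frac.1 * f.frac.2, e.frac.2 * f.frac.1)

lemma eval_frac (ρ : Fin 6 → ℝ) (e : RatExpr) (he : e.Defined ρ) :
    MvPolynomial.eval₂Hom (Int.castRingHom ℝ) ρ e.frac.2 ≠ 0 ∧
      e.eval ρ * MvPolynomial.eval₂Hom (Int.castRingHom ℝ) ρ e.frac.2 =
        MvPolynomial.eval₂Hom (Int.castRingHom ℝ) ρ e.frac.1 := by
  induction e with
  | var t => simp [frac, eval]
  | const z => simp [frac, eval]
  | add e f ihe ihf =>
    obtain ⟨h1, h2⟩ := ihe he.1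
    obtain ⟨h3, h4⟩ := ihf he.2
    refine ⟨by simpa only [frac, map_mul] using mul_ne_zero h1 h3, ?_⟩
    simp only [frac, eval, map_mul, map_add, ← h2, ← h4]
    ring
  | sub e f ihe ihf =>
    obtain ⟨h1, h2⟩ := ihe he.1
    obtain ⟨h3, h4⟩ := ihf he.2
    refine ⟨by simpa only [frac, map_mul] using mul_ne_zero h1 h3, ?_⟩
    simp only [frac, eval, map_mul, map_sub, ← h2, ← h4]
    ring
  | mul e f ihe ihf =>
    obtain ⟨h1, h2⟩ := ihe he.1
    obtain ⟨h3, h4⟩ := ihf he.2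
    refine ⟨by simpa only [frac, map_mul] using mul_ne_zero h1 h3, ?_⟩
    simp only [frac, eval, map_mul, ← h2, ← h4]
    ring
  | div e f ihe ihf =>
    obtain ⟨h1, h2⟩ := ihe he.1
    obtain ⟨h3, h4⟩ := ihf he.2.1
    have h5 := he.2.2
    constructor
    · simp only [frac, map_mul, ← h4]
      exact mul_ne_zero h1 (mul_ne_zero h5 h3)
    · simp only [frac, eval, map_mul, ← h2, ← h4]
      field_simp

/-- A linear polynomial whose root is the value of the expression. -/
noncomputable def poly (e : RatExpr) : Polynomial (MvPolynomial (Fin 6) ℤ) :=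
  Polynomial.C e.frac.2 * Polynomial.X - Polynomial.C e.frac.1

lemma map_poly_ne_zero (ρ : Fin 6 → ℝ) (e : RatExpr) (he : e.Defined ρ) :
    e.poly.map (MvPolynomial.eval₂Hom (Int.castRingHom ℝ) ρ) ≠ 0 := by
  intro h0
  apply (e.eval_frac ρ he).1
  -- The coefficient of `X` is the denominator, which does not vanish at the coordinates.
  have := congrArg (fun q => Polynomial.coeff q 1) h0
  simpa [poly, Polynomial.coeff_C] using this

lemma isRoot_map_poly (ρ : Fin 6 → ℝ) (e : RatExpr) (he : e.Defined ρ) :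
    (e.poly.map (MvPolynomial.eval₂Hom (Int.castRingHom ℝ) ρ)).IsRoot (e.eval ρ) := by
  rw [Polynomial.IsRoot.def]
  simp only [poly, Polynomial.map_sub, Polynomial.map_mul, Polynomial.map_C, Polynomial.map_X,
    Polynomial.eval_sub, Polynomial.eval_mul, Polynomial.eval_C, Polynomial.eval_X]
  rw [sub_eq_zero, mul_comm]
  exact (e.eval_frac ρ he).2

/-- The difference of a coordinate of the second site and one of the first site. -/
def uDiff : Fin 2 → RatExpr
  | 0 => sub (var 2) (var 0)
  | 1 => sub (var 3) (var 1)

/-- The difference of a coordinate of the third site and one of the first site. -/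
def wDiff : Fin 2 → RatExpr
  | 0 => sub (var 4) (var 0)
  | 1 => sub (var 5) (var 1)

/-- The summands of the inner product that defines `cornerInner`. -/
def cornerTerm (x : Fin 2) : RatExpr := mul (wDiff x) (sub (wDiff x) (uDiff x))

/-- The expression for `turn`. -/
def turnExpr : RatExpr := sub (mul (uDiff 0) (wDiff 1)) (mul (uDiff 1) (wDiff 0))

/-- The expression for `cornerInner`. -/
def cornerExpr : RatExpr := add (cornerTerm 0) (cornerTerm 1)

/-- The expression for `centerParam`. -/
def centerExpr : RatExpr := div cornerExpr turnExpr

/-- Twice the difference of the first coordinates of the circumcentre and the first site. -/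
def shiftX : RatExpr := sub (uDiff 0) (mul centerExpr (uDiff 1))

/-- Twice the difference of the second coordinates of the circumcentre and the first site. -/
def shiftY : RatExpr := add (uDiff 1) (mul centerExpr (uDiff 0))

/-- All expressions whose values are stored in real cells. -/
def cellExprs : List RatExpr :=
  [const 2, var 0, var 1, uDiff 0, uDiff 1, mul (uDiff 0) (uDiff 0), mul (uDiff 1) (uDiff 1),
    add (mul (uDiff 0) (uDiff 0)) (mul (uDiff 1) (uDiff 1)),
    mul (uDiff 0) (wDiff 1), mul (uDiff 1) (wDiff 0), turnExpr,
    sub (wDiff 0) (uDiff 0), sub (wDiff 1) (uDiff 1), cornerTerm 0, cornerTerm 1, cornerExpr,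
    centerExpr, mul centerExpr (uDiff 1), shiftX, div shiftX (const 2),
    add (var 0) (div shiftX (const 2)), mul centerExpr (uDiff 0), shiftY, div shiftY (const 2),
    add (var 1) (div shiftY (const 2))]

end RatExpr

open Classical in
/-- The cell bounds of the algorithm. -/
noncomputable def cellBounds : CellBounds where
  exponent := 1
  arity := 6
  polys := (RatExpr.cellExprs.map RatExpr.poly).toFinset

/-- The six coordinates of three sites. -/
def siteCoords (p : Fin n → Plane) (i j k : Fin n) (t : Fin 6) : ℝ :=
  p ((![(i, 0), (i, 1), (j, 0), (j, 1), (k, 0), (k, 1)] : Fin 6 → Fin n × Fin 2) t).1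
    ((![(i, 0), (i, 1), (j, 0), (j, 1), (k, 0), (k, 1)] : Fin 6 → Fin n × Fin 2) t).2

/-- The three sites need not be distinct: values that involve fewer sites are obtained by repeating
an index. -/
lemma fitsReal_eval {e : RatExpr} (i j k : Fin n) (he : e ∈ RatExpr.cellExprs)
    (hd : e.Defined (siteCoords p i j k)) :
    FitsReal cellBounds p (e.eval (siteCoords p i j k)) :=
  ⟨e.poly, List.mem_toFinset.2 (List.mem_map_of_mem he),
    ![(i, 0), (i, 1), (j, 0), (j, 1), (k, 0), (k, 1)], e.map_poly_ne_zero _ hd,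
    e.isRoot_map_poly _ hd⟩

lemma fitsInt_of_abs_le {z : ℤ} (h : |z| ≤ (n : ℤ) + 1) : FitsInt cellBounds n z := by
  simpa [FitsInt, cellBounds] using h

/-! ### Reasoning about programs -/

section

variable {a b : ℕ} {B : CellBounds}

@[simp] lemma State.setInt_ints (σ : State a b) (d : Fin a) (z : ℤ) :
    (σ.setInt d z).ints = Function.update σ.ints d z := rfl
@[simp] lemma State.setInt_reals (σ : State a b) (d : Fin a) (z : ℤ) :
    (σ.setInt d z).reals = σ.reals := rfl
@[simp] lemma State.setReal_ints (σ : State a b) (d : Fin b) (x : ℝ) :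
    (σ.setReal d x).ints = σ.ints := rfl
@[simp] lemma State.setReal_reals (σ : State a b) (d : Fin b) (x : ℝ) :
    (σ.setReal d x).reals = Function.update σ.reals d x := rfl
@[simp] lemma State.setReal_out (σ : State a b) (d : Fin b) (x : ℝ) :
    (σ.setReal d x).out = σ.out := rfl
@[simp] lemma State.emit_ints (σ : State a b) (w : OutWord) : (σ.emit w).ints = σ.ints := rfl
@[simp] lemma State.emit_reals (σ : State a b) (w : OutWord) : (σ.emit w).reals = σ.reals := rfl
@[simp] lemma State.emit_out (σ : State a b) (w : OutWord) :
    (σ.emit w).out = σ.out ++ [w] := rfl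

/-- The program `P`, started in `σ`, halts after at most `c` steps in a state that satisfies
`Q`. -/
def Ends (B : CellBounds) (p : Fin n → Plane) (P : Program a b) (σ : State a b) (c : ℕ)
    (Q : State a b → Prop) : Prop :=
  ∃ T τ, Run B p P σ T τ ∧ T ≤ c ∧ Q τ

lemma Ends.mono {P : Program a b} {σ : State a b} {c d : ℕ} {Q R : State a b → Prop}
    (h : Ends B p P σ c Q) (hcd : c ≤ d) (hQR : ∀ τ, Q τ → R τ) : Ends B p P σ d R := by
  obtain ⟨T, τ, h1, h2, h3⟩ := h
  exact ⟨T, τ, h1, h2.trans hcd, hQR τ h3⟩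

lemma Ends.seq {P P' : Program a b} {σ : State a b} {c d : ℕ} {Q R : State a b → Prop}
    (h : Ends B p P σ c Q) (h' : ∀ τ, Q τ → Ends B p P' τ d R) :
    Ends B p (.seq P P') σ (c + d) R := by
  obtain ⟨T, τ, h1, h2, h3⟩ := h
  obtain ⟨U, ρ, h4, h5, h6⟩ := h' τ h3
  exact ⟨T + U, ρ, .seq _ _ _ _ _ _ _ h1 h4, Nat.add_le_add h2 h5, h6⟩

lemma Ends.branch {P P' : Program a b} {t : Test a b} {σ : State a b} {c : ℕ}
    {Q : State a b → Prop} (h : t.Holds σ → Ends B p P σ c Q)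
    (h' : ¬ t.Holds σ → Ends B p P' σ c Q) : Ends B p (.branch t P P') σ (c + 1) Q := by
  by_cases ht : t.Holds σ
  · obtain ⟨T, τ, h1, h2, h3⟩ := h ht
    exact ⟨T + 1, τ, .branchTrue _ _ _ _ _ _ ht h1, by omega, h3⟩
  · obtain ⟨T, τ, h1, h2, h3⟩ := h' ht
    exact ⟨T + 1, τ, .branchFalse _ _ _ _ _ _ ht h1, by omega, h3⟩

lemma Ends.skip {σ : State a b} {c : ℕ} {Q : State a b → Prop} (hc : 1 ≤ c) (h : Q σ) :
    Ends B p .skip σ c Q :=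
  ⟨1, σ, .skip σ, hc, h⟩

/-- The invariant is indexed by a counter that stays below `N` while the loop runs, which yields
termination. The cost of a round may depend on the counter, so that each cell can be charged its own
number of neighbours. Each round pays one more for its test, and the failing test accounts for the
final one. -/
lemma Ends.loop {P : Program a b} {t : Test a b} (I : ℕ → State a b → Prop) (c : ℕ → ℕ) (N : ℕ)
    (hstep : ∀ m σ, I m σ → t.Holds σ → m < N ∧ Ends B p P σ (c m) (I (m + 1)))
    {m₀ : ℕ} {σ : State a b} (h : I m₀ σ) :
    Ends B p (.loop t P) σ (∑ m ∈ Finset.Ico m₀ N, (c m + 1) + 1)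
      fun τ => (∃ m, I m τ) ∧ ¬ t.Holds τ := by
  induction hd : N - m₀ generalizing m₀ σ with
  | zero =>
    have ht : ¬ t.Holds σ := fun ht => by
      have := (hstep m₀ σ h ht).1
      omega
    exact ⟨1, σ, .loopDone _ _ _ ht, by omega, ⟨m₀, h⟩, ht⟩
  | succ d ih =>
    by_cases ht : t.Holds σ
    · obtain ⟨hlt, T, τ, h1, h2, h3⟩ := hstep m₀ σ h ht
      obtain ⟨U, ρ, h4, h5, h6⟩ := ih h3 (by omega)
      refine ⟨T + 1 + U, ρ, .loopStep _ _ _ _ _ _ _ ht h1 h4, ?_, h6⟩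
      rw [Finset.sum_eq_sum_Ico_succ_bot hlt]
      omega
    · exact ⟨1, σ, .loopDone _ _ _ ht, by omega, ⟨m₀, h⟩, ht⟩

/-- Weakest preconditions of instructions. -/
def Instr.Pre (B : CellBounds) (p : Fin n → Plane) :
    Instr a b → (State a b → Prop) → State a b → Prop
  | .intConst d z, Q, σ => FitsInt B n z ∧ Q (σ.setInt d z)
  | .numSites d, Q, σ => FitsInt B n n ∧ Q (σ.setInt d n)
  | .intCopy d s, Q, σ => FitsInt B n (σ.ints s) ∧ Q (σ.setInt d (σ.ints s))
  | .intAdd d s t, Q, σ =>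
    FitsInt B n (σ.ints s + σ.ints t) ∧ Q (σ.setInt d (σ.ints s + σ.ints t))
  | .intSub d s t, Q, σ =>
    FitsInt B n (σ.ints s - σ.ints t) ∧ Q (σ.setInt d (σ.ints s - σ.ints t))
  | .intMul d s t, Q, σ =>
    FitsInt B n (σ.ints s * σ.ints t) ∧ Q (σ.setInt d (σ.ints s * σ.ints t))
  | .realConst d z, Q, σ => FitsReal B p z ∧ Q (σ.setReal d z)
  | .load d s x, Q, σ => ∃ i : Fin n, σ.ints s = ((i : ℕ) : ℤ) ∧ FitsReal B p (p i x) ∧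
    Q (σ.setReal d (p i x))
  | .realCopy d s, Q, σ => FitsReal B p (σ.reals s) ∧ Q (σ.setReal d (σ.reals s))
  | .realAdd d s t, Q, σ =>
    FitsReal B p (σ.reals s + σ.reals t) ∧ Q (σ.setReal d (σ.reals s + σ.reals t))
  | .realSub d s t, Q, σ =>
    FitsReal B p (σ.reals s - σ.reals t) ∧ Q (σ.setReal d (σ.reals s - σ.reals t))
  | .realMul d s t, Q, σ =>
    FitsReal B p (σ.reals s * σ.reals t) ∧ Q (σ.setReal d (σ.reals s * σ.reals t))
  | .realDiv d s t, Q, σ => σ.reals t ≠ 0 ∧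
    FitsReal B p (σ.reals s / σ.reals t) ∧ Q (σ.setReal d (σ.reals s / σ.reals t))
  | .writeInt s, Q, σ => Q (σ.emit (Sum.inl (σ.ints s)))
  | .writeReal s, Q, σ => Q (σ.emit (Sum.inr (σ.reals s)))

lemma Instr.Pre.exists_step {c : Instr a b} {Q : State a b → Prop} {σ : State a b}
    (h : c.Pre B p Q σ) : ∃ τ, Instr.Step B p c σ τ ∧ Q τ := by
  cases c with
  | intConst d z => exact ⟨_, .intConst _ _ _ h.1, h.2⟩
  | numSites d => exact ⟨_, .numSites _ _ h.1, h.2⟩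
  | intCopy d s => exact ⟨_, .intCopy _ _ _ h.1, h.2⟩
  | intAdd d s t => exact ⟨_, .intAdd _ _ _ _ h.1, h.2⟩
  | intSub d s t => exact ⟨_, .intSub _ _ _ _ h.1, h.2⟩
  | intMul d s t => exact ⟨_, .intMul _ _ _ _ h.1, h.2⟩
  | realConst d z => exact ⟨_, .realConst _ _ _ h.1, h.2⟩
  | load d s x =>
    obtain ⟨i, h1, h2, h3⟩ := h
    exact ⟨_, .load _ _ _ _ i h1 h2, h3⟩
  | realCopy d s => exact ⟨_, .realCopy _ _ _ h.1, h.2⟩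
  | realAdd d s t => exact ⟨_, .realAdd _ _ _ _ h.1, h.2⟩
  | realSub d s t => exact ⟨_, .realSub _ _ _ _ h.1, h.2⟩
  | realMul d s t => exact ⟨_, .realMul _ _ _ _ h.1, h.2⟩
  | realDiv d s t => exact ⟨_, .realDiv _ _ _ _ h.1 h.2.1, h.2.2⟩
  | writeInt s => exact ⟨_, .writeInt _ _, h⟩
  | writeReal s => exact ⟨_, .writeReal _ _, h⟩

/-- Straight-line programs. -/
def block : List (Instr a b) → Program a b
  | [] => .skip
  | c :: cs => .seq (.instr c) (block cs)

/-- Weakest preconditions of straight-line programs. -/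
def BlockPre (B : CellBounds) (p : Fin n → Plane) :
    List (Instr a b) → (State a b → Prop) → State a b → Prop
  | [], Q, σ => Q σ
  | c :: cs, Q, σ => c.Pre B p (BlockPre B p cs Q) σ

/-- The additional step is the `skip` that ends a block. -/
lemma Ends.block {cs : List (Instr a b)} {Q : State a b → Prop} {σ : State a b} {c : ℕ}
    (h : BlockPre B p cs Q σ) (hc : cs.length + 1 ≤ c) :
    Ends B p (LimitedWorkspace.block cs) σ c Q := by
  refine Ends.mono ?_ hc fun _ => id
  clear hc
  induction cs generalizing σ with
  | nil => exact Ends.skip le_rfl h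
  | cons i is ih =>
    obtain ⟨τ, h1, h2⟩ := Instr.Pre.exists_step h
    have : Ends B p (.instr i) σ 1 (BlockPre B p is Q) := ⟨1, τ, .instr _ _ _ h1, le_rfl, h2⟩
    exact (this.seq fun τ hτ => ih hτ).mono (by simp only [List.length_cons]; omega) fun _ => id

end

/-! ### The values that the algorithm stores -/

section

open RatExpr

lemma fitsReal_coord (i : Fin n) (x : Fin 2) : FitsReal cellBounds p (p i x) := by
  fin_cases x
  · exact fitsReal_eval i i i (e := var 0) (by simp [cellExprs]) trivial
  · exact fitsReal_eval i i i (e := var 1) (by simp [cellExprs]) trivial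

lemma fitsReal_diff (i j : Fin n) (x : Fin 2) : FitsReal cellBounds p (p j x - p i x) := by
  fin_cases x
  · exact fitsReal_eval i j i (e := uDiff 0) (by simp [cellExprs]) (by simp [uDiff, Defined])
  · exact fitsReal_eval i j i (e := uDiff 1) (by simp [cellExprs]) (by simp [uDiff, Defined])

lemma fitsReal_two (i : Fin n) : FitsReal cellBounds p ((2 : ℤ) : ℝ) :=
  fitsReal_eval i i i (e := const 2) (by simp [cellExprs]) trivial

lemma fitsReal_sq (i j : Fin n) (x : Fin 2) :
    FitsReal cellBounds p ((p j x - p i x) * (p j x - p i x)) := by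
  fin_cases x
  · exact fitsReal_eval i j i (e := mul (uDiff 0) (uDiff 0)) (by simp [cellExprs])
      (by simp [uDiff, Defined])
  · exact fitsReal_eval i j i (e := mul (uDiff 1) (uDiff 1)) (by simp [cellExprs])
      (by simp [uDiff, Defined])

lemma fitsReal_sqDist (i j : Fin n) :
    FitsReal cellBounds p ((p j 0 - p i 0) * (p j 0 - p i 0) +
      (p j 1 - p i 1) * (p j 1 - p i 1)) :=
  fitsReal_eval i j i (e := add (mul (uDiff 0) (uDiff 0)) (mul (uDiff 1) (uDiff 1)))
    (by simp [cellExprs]) (by simp [uDiff, Defined])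

lemma fitsReal_turn_left (i j k : Fin n) :
    FitsReal cellBounds p ((p j 0 - p i 0) * (p k 1 - p i 1)) :=
  fitsReal_eval i j k (e := mul (uDiff 0) (wDiff 1)) (by simp [cellExprs])
    (by simp [uDiff, wDiff, Defined])

lemma fitsReal_turn_right (i j k : Fin n) :
    FitsReal cellBounds p ((p j 1 - p i 1) * (p k 0 - p i 0)) :=
  fitsReal_eval i j k (e := mul (uDiff 1) (wDiff 0)) (by simp [cellExprs])
    (by simp [uDiff, wDiff, Defined])

lemma fitsReal_turn (i j k : Fin n) : FitsReal cellBounds p (turn p i j k) :=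
  fitsReal_eval i j k (e := turnExpr) (by simp [cellExprs])
    (by simp [turnExpr, uDiff, wDiff, Defined])

lemma fitsReal_diff_sub (i j k : Fin n) (x : Fin 2) :
    FitsReal cellBounds p ((p k x - p i x) - (p j x - p i x)) := by
  fin_cases x
  · exact fitsReal_eval i j k (e := sub (wDiff 0) (uDiff 0)) (by simp [cellExprs])
      (by simp [uDiff, wDiff, Defined])
  · exact fitsReal_eval i j k (e := sub (wDiff 1) (uDiff 1)) (by simp [cellExprs])
      (by simp [uDiff, wDiff, Defined])

lemma fitsReal_cornerTerm (i j k : Fin n) (x : Fin 2) :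
    FitsReal cellBounds p ((p k x - p i x) * ((p k x - p i x) - (p j x - p i x))) := by
  fin_cases x
  · exact fitsReal_eval i j k (e := cornerTerm 0) (by simp [cellExprs])
      (by simp [cornerTerm, uDiff, wDiff, Defined])
  · exact fitsReal_eval i j k (e := cornerTerm 1) (by simp [cellExprs])
      (by simp [cornerTerm, uDiff, wDiff, Defined])

lemma fitsReal_cornerInner (i j k : Fin n) : FitsReal cellBounds p (cornerInner p i j k) :=
  fitsReal_eval i j k (e := cornerExpr) (by simp [cellExprs])
    (by simp [cornerExpr, cornerTerm, uDiff, wDiff, Defined])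

lemma defined_centerExpr {i j k : Fin n} (h : turn p i j k ≠ 0) :
    centerExpr.Defined (siteCoords p i j k) :=
  ⟨by simp [cornerExpr, cornerTerm, uDiff, wDiff, Defined],
    by simp [turnExpr, uDiff, wDiff, Defined], h⟩

lemma fitsReal_centerParam {i j k : Fin n} (h : turn p i j k ≠ 0) :
    FitsReal cellBounds p (centerParam p i j k) :=
  fitsReal_eval i j k (e := centerExpr) (by simp [cellExprs]) (defined_centerExpr h)

lemma fitsReal_centerParam_mul {i j k : Fin n} (h : turn p i j k ≠ 0) (x : Fin 2) :
    FitsReal cellBounds p (centerParam p i j k * (p j x - p i x)) := by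
  fin_cases x
  · exact fitsReal_eval i j k (e := mul centerExpr (uDiff 0)) (by simp [cellExprs])
      ⟨defined_centerExpr h, by simp [uDiff, Defined]⟩
  · exact fitsReal_eval i j k (e := mul centerExpr (uDiff 1)) (by simp [cellExprs])
      ⟨defined_centerExpr h, by simp [uDiff, Defined]⟩

lemma defined_shiftX {i j k : Fin n} (h : turn p i j k ≠ 0) :
    shiftX.Defined (siteCoords p i j k) :=
  ⟨by simp [uDiff, Defined], defined_centerExpr h, by simp [uDiff, Defined]⟩

lemma defined_shiftY {i j k : Fin n} (h : turn p i j k ≠ 0) :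
    shiftY.Defined (siteCoords p i j k) :=
  ⟨by simp [uDiff, Defined], defined_centerExpr h, by simp [uDiff, Defined]⟩

lemma fitsReal_shiftX {i j k : Fin n} (h : turn p i j k ≠ 0) :
    FitsReal cellBounds p ((p j 0 - p i 0) - centerParam p i j k * (p j 1 - p i 1)) :=
  fitsReal_eval i j k (e := shiftX) (by simp [cellExprs]) (defined_shiftX h)

lemma fitsReal_shiftY {i j k : Fin n} (h : turn p i j k ≠ 0) :
    FitsReal cellBounds p ((p j 1 - p i 1) + centerParam p i j k * (p j 0 - p i 0)) :=
  fitsReal_eval i j k (e := shiftY) (by simp [cellExprs]) (defined_shiftY h)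

lemma fitsReal_half_shiftX {i j k : Fin n} (h : turn p i j k ≠ 0) :
    FitsReal cellBounds p
      (((p j 0 - p i 0) - centerParam p i j k * (p j 1 - p i 1)) / ((2 : ℤ) : ℝ)) :=
  fitsReal_eval i j k (e := div shiftX (const 2)) (by simp [cellExprs])
    ⟨defined_shiftX h, trivial, by simp [eval]⟩

lemma fitsReal_half_shiftY {i j k : Fin n} (h : turn p i j k ≠ 0) :
    FitsReal cellBounds p
      (((p j 1 - p i 1) + centerParam p i j k * (p j 0 - p i 0)) / ((2 : ℤ) : ℝ)) :=
  fitsReal_eval i j k (e := div shiftY (const 2)) (by simp [cellExprs])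
    ⟨defined_shiftY h, trivial, by simp [eval]⟩

lemma fitsReal_center_zero {i j k : Fin n} (h : turn p i j k ≠ 0) :
    FitsReal cellBounds p (p i 0 +
      ((p j 0 - p i 0) - centerParam p i j k * (p j 1 - p i 1)) / ((2 : ℤ) : ℝ)) :=
  fitsReal_eval i j k (e := add (var 0) (div shiftX (const 2))) (by simp [cellExprs])
    ⟨trivial, defined_shiftX h, trivial, by simp [eval]⟩

lemma fitsReal_center_one {i j k : Fin n} (h : turn p i j k ≠ 0) :
    FitsReal cellBounds p (p i 1 +
      ((p j 1 - p i 1) + centerParam p i j k * (p j 0 - p i 0)) / ((2 : ℤ) : ℝ)) :=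
  fitsReal_eval i j k (e := add (var 1) (div shiftY (const 2))) (by simp [cellExprs])
    ⟨trivial, defined_shiftY h, trivial, by simp [eval]⟩

end

/-- How an optional site index is stored in an integer cell. -/
def siteCode : Option (Fin n) → ℤ
  | none => -1
  | some k => ((k : ℕ) : ℤ)

lemma siteCode_eq_neg_one_iff {o : Option (Fin n)} : siteCode o = -1 ↔ o = none := by
  match o with
  | none => simp [siteCode]
  | some k => simp only [siteCode, reduceCtorEq]

lemma fitsInt_siteCode (o : Option (Fin n)) : FitsInt cellBounds n (siteCode o) := by
  apply fitsInt_of_abs_le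
  match o with
  | none => simp [siteCode]
  | some k =>
    have := k.2
    simp only [siteCode, Nat.abs_cast]
    omega

lemma fitsInt_nat {k : ℕ} (h : k ≤ n) : FitsInt cellBounds n k := by
  apply fitsInt_of_abs_le
  rw [Nat.abs_cast]
  omega

lemma fitsInt_neg_one : FitsInt cellBounds n (-1) := by
  apply fitsInt_of_abs_le
  simp

lemma fitsInt_one : FitsInt cellBounds n 1 := by
  apply fitsInt_of_abs_le
  simp

/-! ### The program

Integer cells: `0` the current site `i`, `1` the current neighbour `j`, `2` the scan index `k`,
`3` and `4` the sites that bound the edge of `i` and `j` on the left and on the right, `5` the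
first neighbour visited, `10` the site that bounds its edge on the right, `6` the number of sites,
`7`, `8`, `9` the constants `-1`, `1`, `0`. An index `-1` stands for a missing site.

Real cells: `0`, `1` the coordinates of site `i`; `2`, `3` and `4`, `5` the coordinates of sites
`j` and `k` relative to it; `10` the quantity to be minimized or maximized, `11` and `14` its best
values so far; `12`, `13` the constants `0`, `2`; the others hold intermediate results. -/

/-- Make the scanned site the candidate in `d`, with value in `s`, if there is none yet or if
the test succeeds. -/
def updateCandidate (d : Fin 11) (s : Fin 15) (t : Test 11 15) : Program 11 15 :=
  .branch (.intEq d 7) (block [.intCopy d 2, .realCopy s 10])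
    (.branch t (block [.intCopy d 2, .realCopy s 10]) .skip)

/-- Compare the scanned site with the candidates that bound the current edge. -/
def scanSite : Program 11 15 :=
  .branch (.intEq 2 0) .skip (.branch (.intEq 2 1) .skip
    (.seq
      (block [.load 4 2 0, .load 5 2 1, .realSub 4 4 0, .realSub 5 5 1,
        .realMul 8 2 5, .realMul 6 3 4, .realSub 8 8 6,
        .realSub 6 4 2, .realMul 6 4 6, .realSub 7 5 3, .realMul 7 5 7, .realAdd 9 6 7,
        .realDiv 10 9 8])
      (.branch (.realLt 12 8) (updateCandidate 3 11 (.realLt 10 11))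
        (updateCandidate 4 14 (.realLt 14 10)))))

/-- Find the sites that bound the current edge. -/
def scan : Program 11 15 :=
  .seq
    (block [.load 2 1 0, .load 3 1 1, .realSub 2 2 0, .realSub 3 3 1, .intConst 2 0,
      .intConst 3 (-1), .intConst 4 (-1)])
    (.loop (.intLt 2 6) (.seq scanSite (block [.intAdd 2 2 8])))

/-- Find a site nearest to the current one. -/
def findNearest : Program 11 15 :=
  .seq (block [.intConst 1 (-1), .intConst 2 0])
    (.loop (.intLt 2 6)
      (.seq
        (.branch (.intEq 2 0) .skip
          (.seq
            (block [.load 4 2 0, .load 5 2 1, .realSub 4 4 0, .realSub 5 5 1,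
              .realMul 6 4 4, .realMul 7 5 5, .realAdd 10 6 7])
            (updateCandidate 1 11 (.realLt 10 11))))
        (block [.intAdd 2 2 8])))

/-- Write the endpoint determined by the site in `d`, with parameter in `s`. -/
def writeEndpoint (d : Fin 11) (s : Fin 15) : Program 11 15 :=
  .branch (.intEq d 7) (block [.writeInt 9])
    (block [.writeInt 8,
      .realMul 6 s 3, .realSub 6 2 6, .realDiv 6 6 13, .realAdd 6 0 6, .writeReal 6,
      .realMul 6 s 2, .realAdd 6 3 6, .realDiv 6 6 13, .realAdd 6 1 6, .writeReal 6])

/-- Report the current edge unless its second site has the smaller index. -/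
def writeReport : Program 11 15 :=
  .branch (.intLt 0 1)
    (.seq (block [.writeInt 0, .writeInt 1]) (.seq (writeEndpoint 3 11) (writeEndpoint 4 14)))
    .skip

/-- Compute and report the current edge. -/
def visit : Program 11 15 := .seq scan writeReport

/-- Walk around the current cell, from edge to edge by the bounding sites found in `d`. -/
def walk (d : Fin 11) : Program 11 15 :=
  .loop (.intLt 7 1)
    (.branch (.intEq 1 5) (block [.intConst 1 (-1), .intConst 10 (-1)])
      (.seq visit (block [.intCopy 1 d])))

/-- Report the edges of the current cell, starting with the neighbour found last. -/
def walkBoth : Program 11 15 :=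
  .seq (block [.intCopy 5 1])
    (.seq visit (.seq (block [.intCopy 10 4, .intCopy 1 3])
      (.seq (walk 3) (.seq (block [.intCopy 1 10]) (walk 4)))))

/-- Report the edges of the current cell. -/
def treatCell : Program 11 15 :=
  .seq (block [.load 0 0 0, .load 1 0 1])
    (.seq findNearest
      (.seq (.branch (.intLt 7 1) walkBoth .skip) (block [.intAdd 0 0 8])))

/-- Report all edges of the Voronoi diagram. -/
def voronoiProgram : Program 11 15 :=
  -- The integer cells `0` and `9` and the real cell `12` are to hold zero, which they do from the
  -- start.
  .seq (block [.numSites 6, .intConst 7 (-1), .intConst 8 1, .realConst 13 2])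
    (.loop (.intLt 0 6) treatCell)

/-! ### Correctness of the program -/

/-- The cells with fixed roles have their values while the cell of the site `p i` is treated. -/
structure Ready (p : Fin n → Plane) (i : Fin n) (σ : State 11 15) : Prop where
  site : σ.ints 0 = ((i : ℕ) : ℤ)
  count : σ.ints 6 = n
  missing : σ.ints 7 = -1
  one : σ.ints 8 = 1
  zero : σ.ints 9 = 0
  x : σ.reals 0 = p i 0
  y : σ.reals 1 = p i 1
  realZero : σ.reals 12 = 0
  two : σ.reals 13 = ((2 : ℤ) : ℝ)

lemma Ready.congr {i : Fin n} {σ τ : State 11 15} (h : Ready p i σ)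
    (hi : ∀ d ∈ ([0, 6, 7, 8, 9] : List (Fin 11)), τ.ints d = σ.ints d)
    (hr : ∀ d ∈ ([0, 1, 12, 13] : List (Fin 15)), τ.reals d = σ.reals d) : Ready p i τ where
  site := (hi 0 (by decide)).trans h.site
  count := (hi 6 (by decide)).trans h.count
  missing := (hi 7 (by decide)).trans h.missing
  one := (hi 8 (by decide)).trans h.one
  zero := (hi 9 (by decide)).trans h.zero
  x := (hr 0 (by decide)).trans h.x
  y := (hr 1 (by decide)).trans h.y
  realZero := (hr 12 (by decide)).trans h.realZero
  two := (hr 13 (by decide)).trans h.two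

lemma Ready.setInt {i : Fin n} {σ : State 11 15} (h : Ready p i σ) {d : Fin 11} {z : ℤ}
    (hd : d ∉ ([0, 6, 7, 8, 9] : List (Fin 11))) : Ready p i (σ.setInt d z) :=
  h.congr (fun e he => Function.update_of_ne (fun h' : e = d => hd (h' ▸ he)) _ _)
    fun _ _ => rfl

lemma Ready.setReal {i : Fin n} {σ : State 11 15} (h : Ready p i σ) {d : Fin 15} {x : ℝ}
    (hd : d ∉ ([0, 1, 12, 13] : List (Fin 15))) : Ready p i (σ.setReal d x) :=
  h.congr (fun _ _ => rfl)
    fun e he => Function.update_of_ne (fun h' : e = d => hd (h' ▸ he)) _ _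

/-! ### Computing and writing one edge -/

/-- The integer `z` and the real `x` store the best candidate among the first `K` sites. -/
def StoresBest (p : Fin n → Plane) (ε : ℝ) (i j : Fin n) (K : ℕ) (z : ℤ) (x : ℝ) : Prop :=
  ∃ o, IsBest p ε i j K o ∧ z = siteCode o ∧ ∀ k ∈ o, x = centerParam p i j k

/-- The state during the scan for the sites that bound the edge of `p i` and `p j`, when the scan
index is `m` and the first `K` sites have been compared. -/
structure Scanning (p : Fin n → Plane) (i j : Fin n) (σ₀ : State 11 15) (K m : ℕ)
    (σ : State 11 15) : Prop where
  ready : Ready p i σ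
  cur : σ.ints 1 = ((j : ℕ) : ℤ)
  idx : σ.ints 2 = (m : ℤ)
  start : σ.ints 5 = σ₀.ints 5
  other : σ.ints 10 = σ₀.ints 10
  out : σ.out = σ₀.out
  ux : σ.reals 2 = p j 0 - p i 0
  uy : σ.reals 3 = p j 1 - p i 1
  left : StoresBest p 1 i j K (σ.ints 3) (σ.reals 11)
  right : StoresBest p (-1) i j K (σ.ints 4) (σ.reals 14)

lemma StoresBest.keep {ε : ℝ} {i j k : Fin n} {z : ℤ} {x : ℝ} (h : StoresBest p ε i j k z x)
    (hk : k ≠ i → k ≠ j → 0 < ε * turn p i j k → z ≠ -1 ∧ ε * x ≤ ε * centerParam p i j k) :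
    StoresBest p ε i j ((k : ℕ) + 1) z x := by
  obtain ⟨o, ho, hz, hx⟩ := h
  refine ⟨o, ho.keep fun h1 h2 h3 => ?_, hz, hx⟩
  obtain ⟨h4, h5⟩ := hk h1 h2 h3
  match o, hz, hx with
  | none, hz, _ => exact absurd hz h4
  | some b, _, hx => exact ⟨b, rfl, by rwa [← hx b rfl]⟩

lemma StoresBest.replace {ε : ℝ} {i j k : Fin n} {z : ℤ} {x : ℝ} (h : StoresBest p ε i j k z x)
    (hki : k ≠ i) (hkj : k ≠ j) (hpos : 0 < ε * turn p i j k)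
    (hk : z ≠ -1 → ε * centerParam p i j k ≤ ε * x) :
    StoresBest p ε i j ((k : ℕ) + 1) k (centerParam p i j k) := by
  obtain ⟨o, ho, hz, hx⟩ := h
  refine ⟨some k, ho.replace hki hkj hpos fun b hb => ?_, rfl, fun b hb => by
    rw [Option.some_injective _ hb]⟩
  rw [← hx b hb]
  refine hk fun h' => ?_
  rw [h', eq_comm, siteCode_eq_neg_one_iff] at hz
  simp [hz] at hb

/-- Comparing a candidate changes nothing or stores the scanned site and its value. -/
lemma ends_updateCandidate {d : Fin 11} {s : Fin 15} {t : Test 11 15} {σ : State 11 15}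
    {k : Fin n} {x : ℝ} {Q : State 11 15 → Prop} (hs : σ.ints 2 = ((k : ℕ) : ℤ))
    (hx : σ.reals 10 = x) (hfit : FitsReal cellBounds p x)
    (hreplace : σ.ints d = σ.ints 7 ∨ t.Holds σ → Q ((σ.setInt d k).setReal s x))
    (hkeep : σ.ints d ≠ σ.ints 7 → ¬ t.Holds σ → Q σ) :
    Ends cellBounds p (updateCandidate d s t) σ 5 Q := by
  have hb : (σ.ints d = σ.ints 7 ∨ t.Holds σ) →
      Ends cellBounds p (block [.intCopy d 2, .realCopy s 10]) σ 3 Q := by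
    intro h
    refine Ends.block ?_ le_rfl
    simp only [BlockPre, Instr.Pre, hs, State.setInt_reals, hx]
    exact ⟨fitsInt_nat k.2.le, hfit, hreplace h⟩
  refine Ends.branch (fun h => (hb (Or.inl h)).mono (by norm_num) fun _ => id) fun h => ?_
  refine Ends.branch (fun h' => hb (Or.inr h')) fun h' => ?_
  exact Ends.skip (by norm_num) (hkeep h h')

lemma ends_scanSite (hp : GeneralPosition p) {i j k : Fin n} (hij : i ≠ j)
    {σ₀ σ : State 11 15} (h : Scanning p i j σ₀ k k σ) :
    Ends cellBounds p scanSite σ 22 (Scanning p i j σ₀ ((k : ℕ) + 1) k) := by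
  -- The two sites of the edge are never candidates, so skipping them preserves the best ones.
  have hkeep : (k = i ∨ k = j) → Scanning p i j σ₀ ((k : ℕ) + 1) k σ := by
    intro hk
    have : ∀ {q : Prop}, k ≠ i → k ≠ j → q := fun h1 h2 => absurd hk (by simp [h1, h2])
    exact { h with
      left := h.left.keep fun h1 h2 => this h1 h2
      right := h.right.keep fun h1 h2 => this h1 h2 }
  refine Ends.branch (fun ht => Ends.skip (by norm_num) (hkeep (Or.inl ?_))) fun hki => ?_
  · simp only [Test.Holds, h.idx, h.ready.site, Nat.cast_inj] at ht
    exact Fin.ext ht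
  refine Ends.branch (fun ht => Ends.skip (by norm_num) (hkeep (Or.inr ?_))) fun hkj => ?_
  · simp only [Test.Holds, h.idx, h.cur, Nat.cast_inj] at ht
    exact Fin.ext ht
  simp only [Test.Holds, h.idx, h.ready.site, h.cur, Nat.cast_inj, ← Fin.ext_iff] at hki hkj
  have hc : turn p i j k ≠ 0 := hp.turn_ne_zero hij (Ne.symm hki) (Ne.symm hkj)
  refine Ends.seq (c := 14) (d := 6) (Q := fun τ => Scanning p i j σ₀ k k τ ∧
    τ.reals 8 = turn p i j k ∧ τ.reals 10 = centerParam p i j k) (Ends.block ?_ le_rfl) ?_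
  · simp only [BlockPre, Instr.Pre, State.setReal_ints, State.setReal_reals,
      Function.update_apply, Fin.reduceEq, if_true, if_false, h.ready.x, h.ready.y, h.ux, h.uy]
    refine ⟨k, h.idx, fitsReal_coord _ _, k, h.idx, fitsReal_coord _ _, fitsReal_diff _ _ _,
      fitsReal_diff _ _ _, fitsReal_turn_left _ _ _, fitsReal_turn_right _ _ _,
      fitsReal_turn _ _ _, fitsReal_diff_sub _ _ _ _, fitsReal_cornerTerm _ _ _ _,
      fitsReal_diff_sub _ _ _ _, fitsReal_cornerTerm _ _ _ _, fitsReal_cornerInner _ _ _, hc,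
      fitsReal_centerParam hc, ?_, rfl, rfl⟩
    exact
      { ready := by
          refine h.ready.congr (fun _ _ => rfl) ?_
          simp [Function.update_apply]
        cur := h.cur
        idx := h.idx
        start := h.start
        other := h.other
        out := h.out
        ux := by simpa [Function.update_apply] using h.ux
        uy := by simpa [Function.update_apply] using h.uy
        left := by simpa [Function.update_apply] using h.left
        right := by simpa [Function.update_apply] using h.right }
  · rintro τ ⟨hτ, h8, h10⟩
    refine Ends.branch (fun ht => ?_) fun ht => ?_
    · simp only [Test.Holds, h8, hτ.ready.realZero] at ht
      -- A site on the left does not compete on the right.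
      have hr := hτ.right.keep fun _ _ h3 => by linarith
      refine ends_updateCandidate hτ.idx h10 (fitsReal_centerParam hc) (fun h' => ?_)
        fun h1 h2 => ?_
      · have hl := hτ.left.replace hki hkj (by linarith) fun h1 => by
          simp only [Test.Holds, h10, hτ.ready.missing, h1, false_or] at h'
          linarith
        exact
          { ready := (hτ.ready.setInt (by decide)).setReal (by decide)
            cur := hτ.cur
            idx := hτ.idx
            start := hτ.start
            other := hτ.other
            out := hτ.out
            ux := hτ.ux
            uy := hτ.uy
            left := by simpa using hl
            right := by simpa [Function.update_apply] using hr }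
      · refine { hτ with left := hτ.left.keep fun _ _ _ => ?_, right := hr }
        simp only [Test.Holds, h10, not_lt] at h2
        rw [hτ.ready.missing] at h1
        exact ⟨h1, by linarith⟩
    · simp only [Test.Holds, h8, hτ.ready.realZero, not_lt] at ht
      have ht' := lt_of_le_of_ne ht hc
      have hl := hτ.left.keep fun _ _ h3 => by linarith
      refine ends_updateCandidate hτ.idx h10 (fitsReal_centerParam hc) (fun h' => ?_)
        fun h1 h2 => ?_
      · have hr := hτ.right.replace hki hkj (by linarith) fun h1 => by
          simp only [Test.Holds, h10, hτ.ready.missing, h1, false_or] at h'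
          linarith
        exact
          { ready := (hτ.ready.setInt (by decide)).setReal (by decide)
            cur := hτ.cur
            idx := hτ.idx
            start := hτ.start
            other := hτ.other
            out := hτ.out
            ux := hτ.ux
            uy := hτ.uy
            left := by simpa [Function.update_apply] using hl
            right := by simpa using hr }
      · refine { hτ with left := hl, right := hτ.right.keep fun _ _ _ => ?_ }
        simp only [Test.Holds, h10, not_lt] at h2
        rw [hτ.ready.missing] at h1
        exact ⟨h1, by linarith⟩

lemma sum_Ico_const_le (m N c : ℕ) : ∑ _x ∈ Finset.Ico m N, c ≤ N * c := by
  simp only [Finset.sum_const, Nat.card_Ico, smul_eq_mul]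
  exact Nat.mul_le_mul_right _ (Nat.sub_le _ _)

lemma ends_scan (hp : GeneralPosition p) {i j : Fin n} (hij : i ≠ j) {σ : State 11 15}
    (h : Ready p i σ) (hj : σ.ints 1 = ((j : ℕ) : ℤ)) :
    Ends cellBounds p scan σ (25 * n + 9) (Scanning p i j σ n n) := by
  refine (Ends.seq (c := 8) (d := n * 25 + 1) (Q := Scanning p i j σ 0 0)
    (Ends.block ?_ le_rfl) fun τ hτ => ?_).mono (by omega) fun _ => id
  · simp only [BlockPre, Instr.Pre, State.setReal_ints, State.setReal_reals,
      Function.update_apply, Fin.reduceEq, if_true, if_false, h.x, h.y]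
    refine ⟨j, hj, fitsReal_coord _ _, j, hj, fitsReal_coord _ _, fitsReal_diff _ _ _,
      fitsReal_diff _ _ _, fitsInt_nat (Nat.zero_le _), fitsInt_neg_one, fitsInt_neg_one, ?_⟩
    exact
      { ready := by
          refine h.congr ?_ ?_ <;> simp [Function.update_apply]
        cur := hj
        idx := by simp
        start := rfl
        other := rfl
        out := rfl
        ux := by simp
        uy := by simp
        left := ⟨none, isBest_zero _ _ _, by simp [siteCode], by simp⟩
        right := ⟨none, isBest_zero _ _ _, by simp [siteCode], by simp⟩ }
  · refine (Ends.loop (fun m ρ => m ≤ n ∧ Scanning p i j σ m m ρ) (fun _ => 24) n ?_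
      ⟨Nat.zero_le _, hτ⟩).mono (Nat.succ_le_succ (sum_Ico_const_le _ _ _)) ?_
    · rintro m ρ ⟨-, hρ⟩ ht
      simp only [Test.Holds, hρ.idx, hρ.ready.count, Nat.cast_lt] at ht
      refine ⟨ht, Ends.seq (c := 22) (d := 2) (ends_scanSite hp (k := ⟨m, ht⟩) hij hρ)
        fun ξ hξ => Ends.block ?_ le_rfl⟩
      simp only [BlockPre, Instr.Pre, hξ.idx, hξ.ready.one]
      refine ⟨by exact_mod_cast fitsInt_nat (k := m + 1) ht, ht, ?_⟩
      exact
        { ready := hξ.ready.setInt (by decide)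
          cur := hξ.cur
          idx := by simp
          start := hξ.start
          other := hξ.other
          out := hξ.out
          ux := hξ.ux
          uy := hξ.uy
          left := hξ.left
          right := hξ.right }
    · rintro ρ ⟨⟨m, hm, hρ⟩, ht⟩
      simp only [Test.Holds, hρ.idx, hρ.ready.count, Nat.cast_lt, not_lt] at ht
      obtain rfl := le_antisymm hm ht
      exact hρ

/-- The real cell `6` is scratch space, and the parameter in `s` must survive the first coordinate;
hence `s ≠ 6`. -/
lemma ends_writeEndpoint (hp : GeneralPosition p) {i j : Fin n} (hij : i ≠ j) {d : Fin 11}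
    {s : Fin 15} (hs : s ≠ 6) {σ : State 11 15} (h : Ready p i σ)
    (hx : σ.reals 2 = p j 0 - p i 0) (hy : σ.reals 3 = p j 1 - p i 1) {o : Option (Fin n)}
    (ho : ∀ k ∈ o, k ≠ i ∧ k ≠ j) (hd : σ.ints d = siteCode o)
    (hso : ∀ k ∈ o, σ.reals s = centerParam p i j k) :
    Ends cellBounds p (writeEndpoint d s) σ 13 fun τ => τ.ints = σ.ints ∧
      (∀ c, c ≠ 6 → τ.reals c = σ.reals c) ∧
      τ.out = σ.out ++ encodeEndpoint (endpoint p i j o) := by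
  refine Ends.branch (fun ht => Ends.block ?_ (by simp)) fun ht => Ends.block ?_ le_rfl
  · simp only [Test.Holds, hd, h.missing, siteCode_eq_neg_one_iff] at ht
    subst ht
    simp [BlockPre, Instr.Pre, h.zero, endpoint, encodeEndpoint]
  · simp only [Test.Holds, hd, h.missing, siteCode_eq_neg_one_iff] at ht
    obtain ⟨k, rfl⟩ := Option.ne_none_iff_exists'.1 ht
    have hk := ho k rfl
    have hc : turn p i j k ≠ 0 := hp.turn_ne_zero hij hk.1.symm hk.2.symm
    simp only [BlockPre, Instr.Pre, State.setReal_ints, State.setReal_reals, State.emit_ints,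
      State.emit_reals, Function.update_apply, Fin.reduceEq, if_true, if_false, h.x, h.y, h.one,
      h.two, hx, hy, hs, hso k rfl]
    refine ⟨fitsReal_centerParam_mul hc 1, fitsReal_shiftX hc, by norm_num,
      fitsReal_half_shiftX hc, fitsReal_center_zero hc, fitsReal_centerParam_mul hc 0,
      fitsReal_shiftY hc, by norm_num, fitsReal_half_shiftY hc, fitsReal_center_one hc, trivial,
      fun c hc => by simp [hc], ?_⟩
    simp [endpoint, encodeEndpoint]

/-- The sites and parameters found by a scan are those that bound the edge. -/
lemma StoresBest.exists_isNext {ε : ℝ} {i j : Fin n} {z : ℤ} {x : ℝ}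
    (h : StoresBest p ε i j n z x) : ∃ o, IsNext p ε i j o ∧ (∀ k ∈ o, k ≠ i ∧ k ≠ j) ∧
      z = siteCode o ∧ ∀ k ∈ o, x = centerParam p i j k := by
  obtain ⟨o, ho, hz, hx⟩ := h
  refine ⟨o, ho.isNext, ?_, hz, hx⟩
  rintro k rfl
  exact ⟨ho.1, ho.2.1⟩

/-- The state after the edge of `p i` and `p j` has been computed and reported, where `S` is the
set of neighbours visited before. -/
structure Visited (p : Fin n → Plane) (i j : Fin n) (S : Finset (Fin n)) (σ₀ σ : State 11 15) :
    Prop where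
  ready : Ready p i σ
  start : σ.ints 5 = σ₀.ints 5
  other : σ.ints 10 = σ₀.ints 10
  left : ∃ l, IsNext p 1 i j l ∧ σ.ints 3 = siteCode l
  right : ∃ r, IsNext p (-1) i j r ∧ σ.ints 4 = siteCode r
  out : Reported p (Treated p i (insert j S)) σ.out

lemma ends_visit (hp : GeneralPosition p) {i j : Fin n} (hij : Neighbors p i j)
    {S : Finset (Fin n)} (hS : j ∉ S) {σ : State 11 15} (h : Ready p i σ)
    (hj : σ.ints 1 = ((j : ℕ) : ℤ)) (hout : Reported p (Treated p i S) σ.out) :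
    Ends cellBounds p visit σ (25 * n + 39) (Visited p i j S σ) := by
  refine (Ends.seq (d := 30) (ends_scan hp hij.1 h hj) fun τ hτ => ?_)
  obtain ⟨l, hl, hl', hl3, hl11⟩ := hτ.left.exists_isNext
  obtain ⟨r, hr, hr', hr4, hr14⟩ := hτ.right.exists_isNext
  refine Ends.branch (fun ht => ?_) fun ht => Ends.skip (by norm_num) ?_
  · simp only [Test.Holds, hτ.ready.site, hτ.cur, Nat.cast_lt] at ht
    refine Ends.seq (c := 3) (d := 26) (Q := fun ρ => ρ.ints = τ.ints ∧ ρ.reals = τ.reals ∧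
      ρ.out = τ.out ++ [Sum.inl ((i : ℕ) : ℤ), Sum.inl ((j : ℕ) : ℤ)])
      (Ends.block ?_ le_rfl) ?_
    · simp [BlockPre, Instr.Pre, hτ.ready.site, hτ.cur]
    rintro ρ ⟨hρi, hρr, hρo⟩
    have hρ : Ready p i ρ :=
      hτ.ready.congr (fun d _ => congrFun hρi d) fun d _ => congrFun hρr d
    refine Ends.seq (c := 13) (d := 13) (ends_writeEndpoint hp hij.1 (by decide) hρ
      (by rw [hρr, hτ.ux]) (by rw [hρr, hτ.uy]) hl' (by rw [hρi, hl3])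
      (fun k hk => by rw [hρr, hl11 k hk])) ?_
    rintro ξ ⟨hξi, hξr, hξo⟩
    have hξ : Ready p i ξ := by
      refine hρ.congr (fun d _ => congrFun hξi d) fun d hd => hξr d ?_
      rintro rfl
      simp at hd
    refine (ends_writeEndpoint hp hij.1 (by decide) hξ
      (by rw [hξr _ (by decide), hρr, hτ.ux]) (by rw [hξr _ (by decide), hρr, hτ.uy]) hr'
      (by rw [hξi, hρi, hr4]) (fun k hk => by rw [hξr _ (by decide), hρr, hr14 k hk])).mono
      le_rfl ?_
    rintro ζ ⟨hζi, hζr, hζo⟩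
    refine
      { ready := ?_
        start := by rw [hζi, hξi, hρi, hτ.start]
        other := by rw [hζi, hξi, hρi, hτ.other]
        left := ⟨l, hl, by rw [hζi, hξi, hρi, hl3]⟩
        right := ⟨r, hr, by rw [hζi, hξi, hρi, hr4]⟩
        out := ?_ }
    · refine hξ.congr (fun d _ => congrFun hζi d) fun d hd => hζr d ?_
      rintro rfl
      simp at hd
    · have := hout.append (edgeReport_correct hp ht hij hl hr) (not_treated hS)
        fun q => treated_insert q
      rw [hζo, hξo, hρo, hτ.out]
      simpa [EdgeReport.encode, edgeReport] using this
  · simp only [Test.Holds, hτ.ready.site, hτ.cur, Nat.cast_lt] at ht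
    exact
      { ready := hτ.ready
        start := hτ.start
        other := hτ.other
        left := ⟨l, hl, hl3⟩
        right := ⟨r, hr, hr4⟩
        out := by
          rw [hτ.out]
          exact hout.skip (by simpa using ht) fun q => treated_insert q }

/-! ### Walking around one cell -/

/-- The state of a walk around the cell of `p i`, in which the neighbours in `S` have been
visited: either the walk goes on with the site in the integer cell `1`, if there is one, or all
neighbours have been visited. -/
structure Walking (p : Fin n → Plane) (ε : ℝ) (i first s : Fin n) (z : ℤ) (S : Finset (Fin n))
    (σ : State 11 15) : Prop where
  ready : Ready p i σ
  start : σ.ints 5 = ((s : ℕ) : ℤ)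
  mem : s ∈ S
  out : Reported p (Treated p i S) σ.out
  cases : (∃ last o, IsWalk p ε i S first last ∧ IsNext p ε i last o ∧
      σ.ints 1 = siteCode o ∧ σ.ints 10 = z) ∨
    (∀ l, l ∈ S ↔ Neighbors p i l) ∧ σ.ints 1 = -1 ∧ σ.ints 10 = -1

/-- The loop tests for a return to `s`, the neighbour visited first. In the first walk around a cell
`s` is the end `first`; in the second, `first` is an unbounded end, and a return to `s` is
impossible. -/
lemma ends_walk (hp : GeneralPosition p) {ε : ℝ} (hε : ε = 1 ∨ ε = -1) {i first s : Fin n}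
    (hs : s = first ∨ IsNext p (-ε) i first none) {d : Fin 11}
    (hd : ∀ {j S σ τ}, Visited p i j S σ τ → ∃ o, IsNext p ε i j o ∧ τ.ints d = siteCode o)
    {z : ℤ} {S : Finset (Fin n)} {σ : State 11 15} (h : Walking p ε i first s z S σ) :
    Ends cellBounds p (walk d) σ (((neighborFinset p i).card + 1) * (25 * n + 43) + 1)
      fun τ => ∃ S, Walking p ε i first s z S τ ∧ τ.ints 1 = -1 := by
  -- The counter is the number of visited neighbours. The round that detects a closed walk adds
  -- none; therefore the equation is demanded only while the walk goes on, and the bound on the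
  -- counter is one more than the number of neighbours.
  refine (Ends.loop (fun m τ => ∃ S, Walking p ε i first s z S τ ∧ (τ.ints 1 ≠ -1 → m = S.card))
    (fun _ => 25 * n + 42) ((neighborFinset p i).card + 1) ?_ ⟨S, h, fun _ => rfl⟩).mono
    (Nat.succ_le_succ (sum_Ico_const_le _ _ _)) ?_
  · rintro m τ ⟨S, hτ, hm⟩ ht
    simp only [Test.Holds, hτ.ready.missing] at ht
    rcases hτ.cases with ⟨last, o, hw, ho, ho1, hz⟩ | ⟨-, h1, -⟩
    swap
    · exact absurd h1 ht.ne'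
    obtain rfl := hm ht.ne'
    obtain ⟨k, rfl⟩ : ∃ k, o = some k := by
      rw [← Option.ne_none_iff_exists']
      rintro rfl
      exact absurd ho1 ht.ne'
    have hlast := hw.neighbors _ hw.last_mem
    have hsub : S ⊆ neighborFinset p i := fun a ha => mem_neighborFinset.2 (hw.neighbors a ha)
    refine ⟨Nat.lt_succ_of_le (Finset.card_le_card hsub), Ends.branch (fun hk => ?_) fun hk => ?_⟩
    · simp only [Test.Holds, ho1, hτ.start, siteCode, Nat.cast_inj] at hk
      obtain rfl := Fin.ext hk
      -- If the walk started at an unbounded edge, the next site is new, whereas `s` has been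
      -- visited.
      have hkf : k = first := by
        rcases hs with hs | hs
        · exact hs
        · exact absurd hτ.mem (hw.not_mem_of_isNext hp hε ho (hw.ne_first hp hε ho hs))
      subst hkf
      refine Ends.block ?_ (by simp)
      simp only [BlockPre, Instr.Pre]
      refine ⟨fitsInt_neg_one, fitsInt_neg_one, S, ?_, by simp⟩
      exact
        { ready := (hτ.ready.setInt (by decide)).setInt (by decide)
          start := hτ.start
          mem := hτ.mem
          out := hτ.out
          cases := Or.inr ⟨fun l => ⟨hw.neighbors l, hw.mem_of_closed hp hε ho⟩,
            by simp, by simp⟩ }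
    · simp only [Test.Holds, ho1, hτ.start, siteCode, Nat.cast_inj] at hk
      have hkf : k ≠ first := by
        rcases hs with hs | hs
        · exact fun h => hk (by rw [h, hs])
        · exact hw.ne_first hp hε ho hs
      have hkS := hw.not_mem_of_isNext hp hε ho hkf
      refine Ends.seq (d := 2)
        (ends_visit hp (ho.neighbors hp hε hlast) hkS hτ.ready ho1 hτ.out) fun ξ hξ =>
          Ends.block ?_ le_rfl
      obtain ⟨o', ho', hd'⟩ := hd hξ
      simp only [BlockPre, Instr.Pre, hd']
      refine ⟨fitsInt_siteCode _, insert k S, ?_, fun _ => (Finset.card_insert_of_notMem hkS).symm⟩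
      exact
        { ready := hξ.ready.setInt (by decide)
          start := hξ.start.trans hτ.start
          mem := Finset.mem_insert_of_mem hτ.mem
          out := hξ.out
          cases := Or.inl ⟨k, o', hw.insert hp hε ho hkf, ho', by simp, hξ.other.trans hz⟩ }
  · rintro τ ⟨⟨m, S, hτ, -⟩, ht⟩
    refine ⟨S, hτ, ?_⟩
    simp only [Test.Holds, hτ.ready.missing, not_lt] at ht
    rcases hτ.cases with ⟨last, o, -, -, ho1, -⟩ | ⟨-, h1, -⟩
    · rw [ho1] at ht ⊢
      match o with
      | none => rfl
      | some k => simp only [siteCode] at ht; omega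
    · exact h1

lemma ends_walkBoth (hp : GeneralPosition p) {i j : Fin n} (hij : Neighbors p i j)
    {σ : State 11 15} (h : Ready p i σ) (hj : σ.ints 1 = ((j : ℕ) : ℤ))
    (hout : Reported p (Treated p i ∅) σ.out) :
    Ends cellBounds p walkBoth σ ((2 * (neighborFinset p i).card + 3) * (25 * n + 43) + 9)
      fun τ => Ready p i τ ∧ Reported p (Treated p ((i : ℕ) + 1) ∅) τ.out := by
  refine Ends.mono (c := 2 + (25 * n + 39 + (3 +
    ((((neighborFinset p i).card + 1) * (25 * n + 43) + 1) + (2 +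
    (((neighborFinset p i).card + 1) * (25 * n + 43) + 1)))))) ?_ ?_ (fun _ => id)
  swap
  -- Each of the two walks costs one visit per neighbour and one more; the visit of the starting
  -- edge makes the third extra one.
  · have : (2 * (neighborFinset p i).card + 3) * (25 * n + 43) =
      ((neighborFinset p i).card + 1) * (25 * n + 43) +
      ((neighborFinset p i).card + 1) * (25 * n + 43) + (25 * n + 43) := by ring
    omega
  refine Ends.seq (Q := fun τ => Ready p i τ ∧ τ.ints 1 = ((j : ℕ) : ℤ) ∧
    τ.ints 5 = ((j : ℕ) : ℤ) ∧ Reported p (Treated p i ∅) τ.out) (Ends.block ?_ le_rfl) ?_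
  · simp only [BlockPre, Instr.Pre, hj]
    exact ⟨fitsInt_nat j.2.le, h.setInt (by decide), by simpa [Function.update_apply] using hj,
      by simp, hout⟩
  rintro τ ⟨hτ, hτj, hτs, hτo⟩
  refine Ends.seq (ends_visit hp hij (Finset.notMem_empty j) hτ hτj hτo) fun ρ hρ => ?_
  obtain ⟨l, hl, hl3⟩ := hρ.left
  obtain ⟨r, hr, hr4⟩ := hρ.right
  refine Ends.seq (Q := Walking p 1 i j j (siteCode r) {j}) (Ends.block ?_ le_rfl) fun ξ hξ => ?_
  · simp only [BlockPre, Instr.Pre, hr4, State.setInt_ints, Function.update_apply, Fin.reduceEq,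
      if_false, hl3]
    refine ⟨fitsInt_siteCode _, fitsInt_siteCode _, ?_⟩
    exact
      { ready := (hρ.ready.setInt (by decide)).setInt (by decide)
        start := hρ.start.trans hτs
        mem := Finset.mem_singleton_self j
        out := hρ.out
        cases := Or.inl ⟨j, l, IsWalk.singleton hij, hl, by simp,
          by simp⟩ }
  refine Ends.seq (ends_walk hp (Or.inl rfl) (Or.inl rfl) (fun hv => hv.left) hξ) ?_
  rintro ζ ⟨S, hζ, hζ1⟩
  rcases hζ.cases with ⟨last, o, hw, ho, ho1, hz⟩ | ⟨hall, -, h10⟩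
  · obtain rfl : o = none := siteCode_eq_neg_one_iff.1 (ho1.symm.trans hζ1)
    refine Ends.seq (Q := Walking p (-1) i last j (siteCode r) S) (Ends.block ?_ le_rfl)
      fun η hη => ?_
    · simp only [BlockPre, Instr.Pre, hz]
      refine ⟨fitsInt_siteCode _, ?_⟩
      exact
        { ready := hζ.ready.setInt (by decide)
          start := hζ.start
          mem := hζ.mem
          out := hζ.out
          -- Read backwards, the first walk ends at `j`; it goes on with the right bounding site of
          -- that edge, saved in the integer cell `10`.
          cases := Or.inl ⟨j, r, hw.reverse, hr, by simp, hz⟩ }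
    · refine (ends_walk hp (Or.inr rfl) (Or.inr (by rwa [neg_neg])) (fun hv => hv.right) hη).mono
        le_rfl ?_
      rintro θ ⟨S', hθ, hθ1⟩
      refine ⟨hθ.ready, hθ.out.congr (treated_succ fun m => ?_)⟩
      rcases hθ.cases with ⟨last', o', hw', ho', ho1', -⟩ | ⟨hall, -, -⟩
      · obtain rfl : o' = none := siteCode_eq_neg_one_iff.1 (ho1'.symm.trans hθ1)
        exact ⟨hw'.neighbors m, hw'.mem_of_unbounded hp (Or.inr rfl) ho' (by rwa [neg_neg])⟩
      · exact hall m
  · refine Ends.seq (Q := fun η => Ready p i η ∧ η.ints 1 = -1 ∧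
      Reported p (Treated p i S) η.out) (Ends.block ?_ le_rfl) ?_
    · simp only [BlockPre, Instr.Pre, h10]
      exact ⟨fitsInt_neg_one, hζ.ready.setInt (by decide), by simp, hζ.out⟩
    · rintro η ⟨hη, hη1, hηo⟩
      -- The first walk closed up and set the integer cell `10` to `-1`, so the second one stops at
      -- its first test.
      refine ⟨1, η, .loopDone _ _ _ ?_, by omega, hη, hηo.congr (treated_succ hall)⟩
      simp [Test.Holds, hη1, hη.missing]

/-! ### Finding a first neighbour -/

/-- The state during the search for a site nearest to `p i`, when the scan index is `m` and the
first `K` sites have been compared. -/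
structure Nearing (p : Fin n → Plane) (i : Fin n) (σ₀ : State 11 15) (K m : ℕ)
    (σ : State 11 15) : Prop where
  ready : Ready p i σ
  idx : σ.ints 2 = (m : ℤ)
  out : σ.out = σ₀.out
  best : ∃ o, IsNearest p i K o ∧ σ.ints 1 = siteCode o ∧
    ∀ k ∈ o, σ.reals 11 = sqDist (p k) (p i)

lemma ends_findNearest {i : Fin n} {σ : State 11 15} (h : Ready p i σ) :
    Ends cellBounds p findNearest σ (17 * n + 4) (Nearing p i σ n n) := by
  refine (Ends.seq (c := 3) (d := n * 17 + 1) (Q := Nearing p i σ 0 0)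
    (Ends.block ?_ le_rfl) fun τ hτ => ?_).mono (by omega) fun _ => id
  · simp only [BlockPre, Instr.Pre]
    refine ⟨fitsInt_neg_one, fitsInt_nat (Nat.zero_le _), ?_⟩
    exact
      { ready := (h.setInt (by decide)).setInt (by decide)
        idx := by simp
        out := rfl
        best := ⟨none, isNearest_zero _, by simp [siteCode], by simp⟩ }
  · refine (Ends.loop (fun m ρ => m ≤ n ∧ Nearing p i σ m m ρ) (fun _ => 16) n ?_
      ⟨Nat.zero_le _, hτ⟩).mono (Nat.succ_le_succ (sum_Ico_const_le _ _ _)) ?_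
    · rintro m ρ ⟨-, hρ⟩ ht
      simp only [Test.Holds, hρ.idx, hρ.ready.count, Nat.cast_lt] at ht
      obtain ⟨k, rfl⟩ : ∃ k : Fin n, m = k := ⟨⟨m, ht⟩, rfl⟩
      refine ⟨ht, Ends.seq (c := 14) (d := 2) (Q := Nearing p i σ ((k : ℕ) + 1) k) ?_
        fun ξ hξ => Ends.block ?_ le_rfl⟩
      · obtain ⟨o, ho, ho1, ho11⟩ := hρ.best
        refine Ends.branch (fun hki => Ends.skip (by norm_num) ?_) fun hki => ?_
        · simp only [Test.Holds, hρ.idx, hρ.ready.site, Nat.cast_inj, ← Fin.ext_iff] at hki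
          exact { hρ with best := ⟨o, ho.keep fun h' => absurd hki h', ho1, ho11⟩ }
        simp only [Test.Holds, hρ.idx, hρ.ready.site, Nat.cast_inj, ← Fin.ext_iff] at hki
        refine Ends.seq (c := 8) (d := 5) (Q := fun ξ => Ready p i ξ ∧ ξ.ints = ρ.ints ∧
          ξ.out = ρ.out ∧ ξ.reals 11 = ρ.reals 11 ∧
          ξ.reals 10 = (p k 0 - p i 0) * (p k 0 - p i 0) + (p k 1 - p i 1) * (p k 1 - p i 1))
          (Ends.block ?_ le_rfl) ?_
        · simp only [BlockPre, Instr.Pre, State.setReal_ints, State.setReal_reals,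
            Function.update_apply, Fin.reduceEq, if_true, if_false, hρ.ready.x, hρ.ready.y]
          refine ⟨k, hρ.idx, fitsReal_coord _ _, k, hρ.idx, fitsReal_coord _ _,
            fitsReal_diff _ _ _, fitsReal_diff _ _ _, fitsReal_sq _ _ _, fitsReal_sq _ _ _,
            fitsReal_sqDist _ _, ?_, trivial, rfl, trivial, rfl⟩
          refine hρ.ready.congr (fun _ _ => rfl) ?_
          simp [Function.update_apply]
        · rintro ξ ⟨hξ, hξi, hξo, h11, h10⟩
          have hsq : (p k 0 - p i 0) * (p k 0 - p i 0) + (p k 1 - p i 1) * (p k 1 - p i 1) =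
              sqDist (p k) (p i) := by
            unfold sqDist
            ring
          refine ends_updateCandidate (by rw [hξi, hρ.idx]) h10 (fitsReal_sqDist _ _)
            (fun h' => ?_) fun h1 h2 => ?_
          · exact
              { ready := (hξ.setInt (by decide)).setReal (by decide)
                idx := by simp [hξi, hρ.idx]
                out := hξo.trans hρ.out
                best := by
                  refine ⟨some k, ho.replace hki fun b hb => ?_, by simp [siteCode],
                    fun b hb => by simpa [hsq] using by rw [Option.some_injective _ hb]⟩
                  obtain rfl := Option.mem_def.1 hb
                  simp only [Test.Holds, h10, h11, hξi, hρ.ready.missing, ho1,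
                    siteCode_eq_neg_one_iff, reduceCtorEq, false_or, hsq, ho11 b rfl] at h'
                  exact h'.le }
          · exact
              { ready := hξ
                idx := by rw [hξi, hρ.idx]
                out := hξo.trans hρ.out
                best := by
                  refine ⟨o, ho.keep fun _ => ?_, by rw [hξi, ho1], fun b hb => by
                    rw [h11, ho11 b hb]⟩
                  simp only [hξi, hρ.ready.missing, ho1, ne_eq, siteCode_eq_neg_one_iff] at h1
                  obtain ⟨b, rfl⟩ := Option.ne_none_iff_exists'.1 h1
                  refine ⟨b, rfl, ?_⟩
                  simpa only [Test.Holds, h10, h11, ho11 b rfl, hsq, not_lt] using h2 }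
      · simp only [BlockPre, Instr.Pre, hξ.idx, hξ.ready.one]
        refine ⟨by exact_mod_cast fitsInt_nat (k := (k : ℕ) + 1) ht, ht, ?_⟩
        exact
          { ready := hξ.ready.setInt (by decide)
            idx := by simp
            out := hξ.out
            best := hξ.best }
    · rintro ρ ⟨⟨m, hm, hρ⟩, ht⟩
      simp only [Test.Holds, hρ.idx, hρ.ready.count, Nat.cast_lt, not_lt] at ht
      obtain rfl := le_antisymm hm ht
      exact hρ

/-! ### The loop over all cells and the total running time -/

/-- The state when the cells of the first `m` sites have been treated. -/
structure CellsTreated (p : Fin n → Plane) (m : ℕ) (σ : State 11 15) : Prop where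
  le : m ≤ n
  site : σ.ints 0 = (m : ℤ)
  count : σ.ints 6 = n
  missing : σ.ints 7 = -1
  one : σ.ints 8 = 1
  zero : σ.ints 9 = 0
  realZero : σ.reals 12 = 0
  two : σ.reals 13 = ((2 : ℤ) : ℝ)
  out : Reported p (Treated p m ∅) σ.out

/-- A bound for the time in which the cell of the site `p i` is treated. -/
noncomputable def cellCost (p : Fin n → Plane) (i : Fin n) : ℕ :=
  (2 * (neighborFinset p i).card + 3) * (25 * n + 43) + 17 * n + 19

lemma ends_treatCell (hp : GeneralPosition p) {i : Fin n} {σ : State 11 15}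
    (h : CellsTreated p i σ) :
    Ends cellBounds p treatCell σ (cellCost p i) (CellsTreated p ((i : ℕ) + 1)) := by
  refine Ends.mono (c := 3 + ((17 * n + 4) +
    (((2 * (neighborFinset p i).card + 3) * (25 * n + 43) + 9 + 1) + 2))) ?_
    (by unfold cellCost; omega) fun _ => id
  refine Ends.seq (Q := fun τ => Ready p i τ ∧ τ.out = σ.out) (Ends.block ?_ le_rfl) ?_
  · simp only [BlockPre, Instr.Pre, State.setReal_ints]
    refine ⟨i, h.site, fitsReal_coord _ _, i, h.site, fitsReal_coord _ _, ?_, rfl⟩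
    exact
      { site := h.site
        count := h.count
        missing := h.missing
        one := h.one
        zero := h.zero
        x := by simp
        y := by simp
        realZero := by simpa [Function.update_apply] using h.realZero
        two := by simpa [Function.update_apply] using h.two }
  rintro τ ⟨hτ, hτo⟩
  refine Ends.seq (ends_findNearest hτ) fun ρ hρ => ?_
  refine Ends.seq (Q := fun ξ => Ready p i ξ ∧ Reported p (Treated p ((i : ℕ) + 1) ∅) ξ.out)
    ?_ ?_
  · have hρo : Reported p (Treated p i ∅) ρ.out := by
      rw [hρ.out, hτo]
      exact h.out
    obtain ⟨o, ho, ho1, -⟩ := hρ.best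
    match o, ho, ho1 with
    -- Here `i` is the only site, and its cell has no edges.
    | none, ho, ho1 =>
      refine Ends.branch (fun ht => ?_) fun _ => Ends.skip (by omega) ⟨hρ.ready, ?_⟩
      · simp [Test.Holds, hρ.ready.missing, ho1, siteCode] at ht
      · exact hρo.congr (treated_succ fun l =>
          ⟨fun hl => absurd hl (Finset.notMem_empty l), fun hl => absurd (ho l l.2).symm hl.1⟩)
    | some j, ho, ho1 =>
      refine Ends.branch (fun _ => ?_) fun ht => ?_
      · exact ends_walkBoth hp (neighbors_of_nearest hp ho.1 fun k hk => ho.2 k k.2 hk) hρ.ready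
          ho1 hρo
      · simp only [Test.Holds, hρ.ready.missing, ho1, siteCode] at ht
        omega
  · rintro ξ ⟨hξ, hξo⟩
    refine Ends.block ?_ le_rfl
    simp only [BlockPre, Instr.Pre, hξ.site, hξ.one]
    refine ⟨by exact_mod_cast fitsInt_nat (k := (i : ℕ) + 1) i.2, ?_⟩
    exact
      { le := i.2
        site := by simp
        count := hξ.count
        missing := hξ.missing
        one := hξ.one
        zero := hξ.zero
        realZero := hξ.realZero
        two := hξ.two
        out := hξo }

lemma sum_cellCost_le (hp : GeneralPosition p) :
    ∑ i, (cellCost p i + 1) ≤ 41 * n * (25 * n + 43) + n * (17 * n + 20) := by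
  have h1 : ∑ i, (cellCost p i + 1) =
      (2 * ∑ i, (neighborFinset p i).card + 3 * n) * (25 * n + 43) + n * (17 * n + 20) := by
    have : ∀ i : Fin n, cellCost p i + 1 =
        (2 * (neighborFinset p i).card + 3) * (25 * n + 43) + (17 * n + 20) := fun i => rfl
    simp only [this, Finset.sum_add_distrib, ← Finset.sum_mul, ← Finset.mul_sum,
      Finset.sum_const, Finset.card_univ, Fintype.card_fin, smul_eq_mul]
    ring
  rw [h1]
  -- The factor `41` is `2 * 19 + 3`, with `19 * n` bounding the total number of neighbours.
  refine Nat.add_le_add_right (Nat.mul_le_mul_right _ ?_) _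
  have := sum_card_neighborFinset_le hp
  omega

theorem ends_voronoiProgram (hn : 1 ≤ n) (hp : GeneralPosition p) :
    Ends cellBounds p voronoiProgram (State.init 11 15) (3000 * n ^ 2)
      fun τ => ReportsVoronoiEdges p τ.out := by
  refine Ends.mono (c := 5 + (∑ i, (cellCost p i + 1) + 1)) ?_ ?_ fun _ => id
  swap
  · have := sum_cellCost_le hp
    -- The total is at most `1042 * n ^ 2 + 1783 * n + 6`, and `1 ≤ n`.
    nlinarith
  refine Ends.seq (Q := CellsTreated p 0) (Ends.block ?_ le_rfl) fun τ hτ => ?_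
  · simp only [BlockPre, Instr.Pre]
    -- Even a constant needs a site to fit into a real cell, since the polynomial's six variables
    -- have to be assigned input coordinates.
    refine ⟨fitsInt_nat le_rfl, fitsInt_neg_one, fitsInt_one, fitsReal_two ⟨0, hn⟩, ?_⟩
    exact
      { le := Nat.zero_le _
        site := rfl
        count := by simp
        missing := by simp
        one := by simp
        zero := rfl
        realZero := rfl
        two := by simp
        out := ⟨[], rfl, by simp, by simp, fun i j _ h => by simp [Treated] at h⟩ }
  · refine (Ends.loop (CellsTreated p)
      -- The value `0` is never used, as the counter is below `n` in every round.
      (fun m => if hm : m < n then cellCost p ⟨m, hm⟩ else 0) n ?_ hτ).mono ?_ ?_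
    · intro m σ h ht
      simp only [Test.Holds, h.site, h.count, Nat.cast_lt] at ht
      refine ⟨ht, ?_⟩
      rw [dif_pos ht]
      exact ends_treatCell hp (i := ⟨m, ht⟩) h
    · rw [← Finset.range_eq_Ico, Finset.sum_range]
      simp
    · rintro σ ⟨⟨m, h⟩, ht⟩
      simp only [Test.Holds, h.site, h.count, Nat.cast_lt, not_lt] at ht
      obtain rfl := le_antisymm h.le ht
      exact h.out.reportsVoronoiEdges hp

end LimitedWorkspace

theorem theorem1 :
    ∃ (a b : ℕ) (P : Program a b) (B : CellBounds) (C : ℕ),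
      ∀ (n : ℕ) (p : Fin n → Plane), 1 ≤ n → GeneralPosition p →
        ∃ (T : ℕ) (τ : State a b),
          Run B p P (State.init a b) T τ ∧
          T ≤ C * n ^ 2 ∧
          ReportsVoronoiEdges p τ.out :=
  ⟨11, 15, voronoiProgram, cellBounds, 3000, fun _ _ hn hp => ends_voronoiProgram hn hp⟩
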